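/- A 0-1 matrix $M$ contains a 0-1 matrix $P$ if some submatrix of $M$ (obtained by deleting rows and columns, keeping the order) either equals $P$ or can be turned into $P$ by changing some ones to zeroes; otherwise $M$ avoids $P$. Let $\mathrm{ex}(n,P)$ be the maximum number of ones in an $n\times n$ 0-1 matrix that avoids $P$ (and $0$ if there is no such matrix). A 0-1 matrix $P$ is called minimally non-linear if $\mathrm{ex}(n,P)=\omega(n)$, but $\mathrm{ex}(n,P')=O(n)$ for every 0-1 matrix $P'\neq P$ that is contained in $P$. For every integer $k>2$, the number of minimally non-linear 0-1 matrices with $k$ rows (and any number of columns) is finite and at most $$\sum_{i=\lceil (k+4)/4\rceil}^{4k-4}\bigl(i^k-(i-1)^k\bigr)\,k^{\,i-1}.$$ -/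

import Mathlib

open Filter Asymptotics

/-- A 0-1 matrix of arbitrary finite size; `true` stands for a one, `false` for a zero. -/
structure ZeroOneMatrix where
  /-- number of rows -/
  rows : ℕ
  /-- number of columns -/
  cols : ℕ
  /-- the entries -/
  entry : Matrix (Fin rows) (Fin cols) Bool

namespace ZeroOneMatrix

/-- `M.Contains P`: some submatrix of `M` (rows and columns kept in order) equals `P` or can be
turned into `P` by changing some ones to zeroes. -/
def Contains (M P : ZeroOneMatrix) : Prop :=
  ∃ (r : Fin P.rows ↪o Fin M.rows) (c : Fin P.cols ↪o Fin M.cols),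
    ∀ i j, P.entry i j = true → M.entry (r i) (c j) = true

/-- `M` avoids `P` if it does not contain `P`. -/
def Avoids (M P : ZeroOneMatrix) : Prop := ¬ M.Contains P

/-- The number of ones of `M`. -/
def ones (M : ZeroOneMatrix) : ℕ :=
  (Finset.univ.filter fun p : Fin M.rows × Fin M.cols => M.entry p.1 p.2 = true).card

open Classical in
/-- The extremal function: the maximum number of ones in an `n × n` 0-1 matrix that avoids `P`
(and `0` if there is no such matrix). -/
noncomputable def ex (n : ℕ) (P : ZeroOneMatrix) : ℕ :=
  (Finset.univ.filter fun A : Matrix (Fin n) (Fin n) Bool => Avoids ⟨n, n, A⟩ P).sup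
    fun A => ones ⟨n, n, A⟩

/-- `P` is minimally non-linear: `ex(n, P) = ω(n)`, but `ex(n, P') = O(n)` for every `P'` that is
contained in `P` and different from `P`. -/
def MinimallyNonlinear (P : ZeroOneMatrix) : Prop :=
  ((fun n : ℕ => (n : ℝ)) =o[atTop] fun n : ℕ => (ex n P : ℝ)) ∧
    ∀ P' : ZeroOneMatrix, P.Contains P' → P' ≠ P →
      (fun n : ℕ => (ex n P' : ℝ)) =O[atTop] fun n : ℕ => (n : ℝ)

end ZeroOneMatrix

/-! A matrix is treated as its set of ones. `Embeds` asks for monotonicity only on occupied lines,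
and `LinearPattern Q` bounds Q-free sets by a constant times the number of occupied lines. This
notion agrees with `ex(n, P) = O(n)` (`linearPattern_of_isBigO`, `exists_ex_le_of_linearPattern`),
so a minimally non-linear matrix has no empty line and its ones form a `MinimalPattern`: not linear,
although every proper subset is. Two four-element patterns are non-linear: the fork, in which two
rows share a column and each has a further one to its right (`not_linearPattern_fork`), and the
alternation a, b, a, b of two rows over four increasing columns (`not_linearPattern_alternation`). A
minimal pattern that contains either of them equals it. Conversely, adding a new column with a
single one keeps a pattern linear if the adjacent columns have ones in the same row
(`insert_between`, `insert_first`, `insert_last`). Number of columns: choose one row per column with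
as many changes of row as possible. Without alternations, a sequence over k rows has at most 2(k -
1) changes. By the insertion lemmas and maximality, no entry agrees with all its neighbours, so
there are at most twice as many columns as changes: c ≤ 4k - 4 (`cols_le`). Transposing gives k ≤ 4c
- 4, the lower end of the sum. Number of matrices: for k > 2 forks are excluded, so each column has
at most one one that is not the last of its row. The matrix is then determined by the last one of
each row, where some row ends in the last column (i^k - (i-1)^k choices), and by one row for each
other column (k^(i-1) choices). -/

namespace ZeroOneMatrix

/-- The set `S` of ones contains the pattern `Q` of ones. -/
def Embeds {α β γ δ : Type} [LinearOrder α] [LinearOrder β] [LinearOrder γ] [LinearOrder δ]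
    (S : Finset (α × β)) (Q : Finset (γ × δ)) : Prop :=
  ∃ (f : γ → α) (g : δ → β), StrictMonoOn f (Prod.fst '' (Q : Set (γ × δ))) ∧
    StrictMonoOn g (Prod.snd '' (Q : Set (γ × δ))) ∧ ∀ x ∈ Q, (f x.1, g x.2) ∈ S

/-- The number of nonempty rows plus the number of nonempty columns. -/
def lines {α β : Type} [DecidableEq α] [DecidableEq β] (S : Finset (α × β)) : ℕ :=
  (S.image Prod.fst).card + (S.image Prod.snd).card

/-- Sets of ones avoiding `Q` have size linear in the number of nonempty lines. -/
def LinearPattern {γ δ : Type} [LinearOrder γ] [LinearOrder δ] (Q : Finset (γ × δ)) : Prop :=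
  ∃ C : ℕ, ∀ S : Finset (ℕ × ℕ), ¬ Embeds S Q → S.card ≤ C * lines S

/-! ### Containment and linearity for sets of ones in arbitrary linear orders. -/

section Basic

variable {α β γ δ α' β' γ' δ' : Type} [LinearOrder α] [LinearOrder β] [LinearOrder γ]
  [LinearOrder δ] [LinearOrder α'] [LinearOrder β'] [LinearOrder γ'] [LinearOrder δ']

theorem lines_mono {S T : Finset (α × β)} (h : S ⊆ T) : lines S ≤ lines T :=
  Nat.add_le_add (Finset.card_le_card (Finset.image_subset_image h))
    (Finset.card_le_card (Finset.image_subset_image h))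

theorem lines_image_le (S : Finset (α × β)) (φ : α → α') (ψ : β → β') :
    lines (S.image (Prod.map φ ψ)) ≤ lines S := by
  unfold lines
  have h1 : (S.image (Prod.map φ ψ)).image Prod.fst = (S.image Prod.fst).image φ := by
    rw [Finset.image_image, Finset.image_image]; rfl
  have h2 : (S.image (Prod.map φ ψ)).image Prod.snd = (S.image Prod.snd).image ψ := by
    rw [Finset.image_image, Finset.image_image]; rfl
  rw [h1, h2]
  exact Nat.add_le_add Finset.card_image_le Finset.card_image_le

theorem lines_swap (S : Finset (α × β)) : lines (S.image Prod.swap) = lines S := by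
  unfold lines
  rw [Finset.image_image, Finset.image_image, add_comm]
  rfl

theorem Embeds.mono {S T : Finset (α × β)} {Q R : Finset (γ × δ)} (h : Embeds S Q)
    (hST : S ⊆ T) (hQ : R ⊆ Q) : Embeds T R := by
  obtain ⟨f, g, hf, hg, h⟩ := h
  exact ⟨f, g, hf.mono (Set.image_mono (by exact_mod_cast hQ)),
    hg.mono (Set.image_mono (by exact_mod_cast hQ)), fun x hx => hST (h x (hQ hx))⟩

theorem Embeds.trans {S : Finset (α × β)} {T : Finset (α' × β')} {Q : Finset (γ × δ)}
    (h : Embeds S T) (h' : Embeds T Q) : Embeds S Q := by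
  obtain ⟨f, g, hf, hg, h⟩ := h
  obtain ⟨f', g', hf', hg', h'⟩ := h'
  refine ⟨f ∘ f', g ∘ g', hf.comp hf' ?_, hg.comp hg' ?_, fun x hx => h _ (h' x hx)⟩
  · rintro _ ⟨x, hx, rfl⟩
    exact ⟨_, h' x hx, rfl⟩
  · rintro _ ⟨x, hx, rfl⟩
    exact ⟨_, h' x hx, rfl⟩

theorem Embeds.swap {S : Finset (α × β)} {Q : Finset (γ × δ)}
    (h : Embeds S Q) : Embeds (S.image Prod.swap) (Q.image Prod.swap) := by
  obtain ⟨f, g, hf, hg, h⟩ := h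
  refine ⟨g, f, hg.mono ?_, hf.mono ?_, ?_⟩
  · rintro _ ⟨x, hx, rfl⟩
    obtain ⟨y, hy, rfl⟩ := Finset.mem_image.1 (Finset.mem_coe.1 hx)
    exact ⟨y, hy, rfl⟩
  · rintro _ ⟨x, hx, rfl⟩
    obtain ⟨y, hy, rfl⟩ := Finset.mem_image.1 (Finset.mem_coe.1 hx)
    exact ⟨y, hy, rfl⟩
  · intro x hx
    obtain ⟨y, hy, rfl⟩ := Finset.mem_image.1 hx
    exact Finset.mem_image.2 ⟨_, h y hy, rfl⟩

theorem swap_swap_image (S : Finset (α × β)) : (S.image Prod.swap).image Prod.swap = S := by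
  rw [Finset.image_image]; simp

theorem exists_strictMonoOn_factor [Nonempty γ] {s : Set α} {φ : α → β} (hφ : StrictMonoOn φ s)
    {f : α → γ} (hf : StrictMonoOn f s) :
    ∃ f' : β → γ, StrictMonoOn f' (φ '' s) ∧ ∀ a ∈ s, f' (φ a) = f a := by
  classical
  have key : ∃ f' : β → γ, ∀ a ∈ s, f' (φ a) = f a := by
    refine ⟨fun b => if h : ∃ a ∈ s, φ a = b then f h.choose else Classical.arbitrary γ, ?_⟩
    intro a ha
    have h : ∃ a' ∈ s, φ a' = φ a := ⟨a, ha, rfl⟩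
    refine (dif_pos h).trans ?_
    exact congrArg f (hφ.injOn h.choose_spec.1 ha h.choose_spec.2)
  obtain ⟨f', h⟩ := key
  refine ⟨f', ?_, h⟩
  rintro _ ⟨a, ha, rfl⟩ _ ⟨b, hb, rfl⟩ hab
  rw [h a ha, h b hb]
  exact hf ha hb ((hφ.lt_iff_lt ha hb).1 hab)

/-- Monotone relabelling of the occupied lines of the pattern changes nothing, because an embedding
ignores the empty ones. -/
theorem Embeds.image [Nonempty α] [Nonempty β] {S : Finset (α × β)} {Q : Finset (γ × δ)}
    (h : Embeds S Q) {φ : γ → γ'} {ψ : δ → δ'}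
    (hφ : StrictMonoOn φ (Prod.fst '' (Q : Set (γ × δ))))
    (hψ : StrictMonoOn ψ (Prod.snd '' (Q : Set (γ × δ)))) :
    Embeds S (Q.image (Prod.map φ ψ)) := by
  obtain ⟨f, g, hf, hg, h⟩ := h
  obtain ⟨f', hf', hff⟩ := exists_strictMonoOn_factor hφ hf
  obtain ⟨g', hg', hgg⟩ := exists_strictMonoOn_factor hψ hg
  refine ⟨f', g', hf'.mono ?_, hg'.mono ?_, ?_⟩
  · rintro _ ⟨x, hx, rfl⟩
    obtain ⟨y, hy, rfl⟩ := Finset.mem_image.1 (Finset.mem_coe.1 hx)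
    exact ⟨_, ⟨y, hy, rfl⟩, rfl⟩
  · rintro _ ⟨x, hx, rfl⟩
    obtain ⟨y, hy, rfl⟩ := Finset.mem_image.1 (Finset.mem_coe.1 hx)
    exact ⟨_, ⟨y, hy, rfl⟩, rfl⟩
  · intro x hx
    obtain ⟨y, hy, rfl⟩ := Finset.mem_image.1 hx
    have := h y hy
    simp only [Prod.map_fst, Prod.map_snd]
    rwa [hff _ ⟨y, hy, rfl⟩, hgg _ ⟨y, hy, rfl⟩]

theorem LinearPattern.image {Q : Finset (γ × δ)} (h : LinearPattern Q) {φ : γ → γ'} {ψ : δ → δ'}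
    (hφ : StrictMono φ) (hψ : StrictMono ψ) : LinearPattern (Q.image (Prod.map φ ψ)) := by
  obtain ⟨C, hC⟩ := h
  exact ⟨C, fun S hS => hC S fun h => hS (h.image (hφ.strictMonoOn _) (hψ.strictMonoOn _))⟩

theorem LinearPattern.swap {Q : Finset (γ × δ)} (h : LinearPattern Q) :
    LinearPattern (Q.image Prod.swap) := by
  obtain ⟨C, hC⟩ := h
  refine ⟨C, fun S hS => ?_⟩
  have := hC (S.image Prod.swap) fun h => hS (by simpa [swap_swap_image] using h.swap)
  rwa [lines_swap, Finset.card_image_of_injective _ Prod.swap_injective] at this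

theorem linearPattern_swap_iff {Q : Finset (γ × δ)} :
    LinearPattern (Q.image Prod.swap) ↔ LinearPattern Q :=
  ⟨fun h => by simpa [swap_swap_image] using h.swap, fun h => h.swap⟩

/-- The position of `x` in the finite set `s`. -/
def position (s : Finset α) (x : α) : ℕ := (s.filter (· < x)).card

theorem position_strictMonoOn (s : Finset α) : StrictMonoOn (position s) s := by
  intro x hx y _ hxy
  refine Finset.card_lt_card (Finset.ssubset_iff_of_subset ?_ |>.2 ⟨x, ?_, ?_⟩)
  · intro z hz
    rw [Finset.mem_filter] at hz ⊢
    exact ⟨hz.1, hz.2.trans hxy⟩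
  · exact Finset.mem_filter.2 ⟨hx, hxy⟩
  · simp

theorem position_lt {s : Finset α} {x : α} (hx : x ∈ s) : position s x < s.card := by
  refine Finset.card_lt_card (Finset.ssubset_iff_of_subset (Finset.filter_subset _ _) |>.2
    ⟨x, hx, by simp⟩)

/-- The set of ones with empty rows and columns squeezed out. -/
def squeeze (S : Finset (α × β)) : Finset (ℕ × ℕ) :=
  S.image (Prod.map (position (S.image Prod.fst)) (position (S.image Prod.snd)))

theorem position_fst_strictMonoOn {β : Type} (S : Finset (α × β)) :
    StrictMonoOn (position (S.image Prod.fst)) (Prod.fst '' (S : Set (α × β))) := by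
  simpa using position_strictMonoOn (S.image Prod.fst)

theorem position_snd_strictMonoOn {α : Type} (S : Finset (α × β)) :
    StrictMonoOn (position (S.image Prod.snd)) (Prod.snd '' (S : Set (α × β))) := by
  simpa using position_strictMonoOn (S.image Prod.snd)

theorem card_squeeze (S : Finset (α × β)) : (squeeze S).card = S.card := by
  refine Finset.card_image_of_injOn ?_
  intro x hx y hy h
  simp only [Prod.map, Prod.mk.injEq] at h
  exact Prod.ext ((position_fst_strictMonoOn S).injOn ⟨x, hx, rfl⟩ ⟨y, hy, rfl⟩ h.1)
    ((position_snd_strictMonoOn S).injOn ⟨x, hx, rfl⟩ ⟨y, hy, rfl⟩ h.2)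

theorem embeds_squeeze {S : Finset (α × β)} (hS : S.Nonempty) : Embeds S (squeeze S) := by
  obtain ⟨x, -⟩ := hS
  have : Nonempty α := ⟨x.1⟩
  have : Nonempty β := ⟨x.2⟩
  have h : Embeds S S := ⟨id, id, strictMono_id.strictMonoOn _, strictMono_id.strictMonoOn _,
    fun x hx => hx⟩
  exact h.image (position_fst_strictMonoOn S) (position_snd_strictMonoOn S)

/-- Linear patterns bound sets of ones with rows and columns in arbitrary linear orders. -/
theorem LinearPattern.card_le {Q : Finset (γ × δ)} (h : LinearPattern Q) :
    ∃ C : ℕ, ∀ (α β : Type) [LinearOrder α] [LinearOrder β] (S : Finset (α × β)),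
      ¬ Embeds S Q → S.card ≤ C * lines S := by
  obtain ⟨C, hC⟩ := h
  refine ⟨C, fun α β _ _ S hS => ?_⟩
  rcases S.eq_empty_or_nonempty with rfl | hne
  · simp
  · have := hC (squeeze S) fun h => hS ((embeds_squeeze hne).trans h)
    rw [card_squeeze] at this
    exact this.trans (Nat.mul_le_mul_left _ (lines_image_le _ _ _))

theorem LinearPattern.mono {Q R : Finset (γ × δ)} (h : LinearPattern Q) (hR : R ⊆ Q) :
    LinearPattern R := by
  obtain ⟨C, hC⟩ := h
  exact ⟨C, fun S hS => hC S fun h => hS (h.mono subset_rfl hR)⟩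

/-! ### Inserting a column with a single one -/

/-- Since j is a new column, the embedding of Q can be redefined at j alone; the hypotheses on y say
that y fits in the corresponding gap. -/
theorem Embeds.insert_col {S T : Finset (α × β)} {Q : Finset (γ × δ)} {i : γ} {j : δ}
    {f : γ → α} {g : δ → β} {y : β}
    (hf : StrictMonoOn f (Prod.fst '' (Q : Set (γ × δ))))
    (hg : StrictMonoOn g (Prod.snd '' (Q : Set (γ × δ))))
    (h : ∀ x ∈ Q, (f x.1, g x.2) ∈ T) (hTS : T ⊆ S)
    (hi : ∃ x ∈ Q, x.1 = i) (hy : (f i, y) ∈ S)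
    (hlt : ∀ x ∈ Q, x.2 < j → g x.2 < y) (hgt : ∀ x ∈ Q, j < x.2 → y < g x.2)
    (hj : ∀ x ∈ Q, x.2 ≠ j) : Embeds S (insert (i, j) Q) := by
  classical
  have hup : ∀ x ∈ Q, Function.update g j y x.2 = g x.2 := fun x hx =>
    Function.update_of_ne (hj x hx) _ _
  refine ⟨f, Function.update g j y, hf.mono ?_, ?_, ?_⟩
  · rintro _ ⟨x, hx, rfl⟩
    rcases Finset.mem_insert.1 (Finset.mem_coe.1 hx) with rfl | hx
    · obtain ⟨x, hx, h⟩ := hi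
      exact ⟨x, hx, h⟩
    · exact ⟨x, hx, rfl⟩
  · rintro _ ⟨x, hx, rfl⟩ _ ⟨x', hx', rfl⟩ hlt'
    rcases Finset.mem_insert.1 (Finset.mem_coe.1 hx) with rfl | hx <;>
    rcases Finset.mem_insert.1 (Finset.mem_coe.1 hx') with rfl | hx'
    · exact absurd hlt' (lt_irrefl _)
    · rw [hup _ hx']; simpa using hgt _ hx' hlt'
    · rw [hup _ hx]; simpa using hlt _ hx hlt'
    · rw [hup _ hx, hup _ hx']
      exact hg ⟨x, hx, rfl⟩ ⟨x', hx', rfl⟩ hlt'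
  · intro x hx
    rcases Finset.mem_insert.1 hx with rfl | hx
    · simpa using hy
    · rw [hup _ hx]; exact hTS (h x hx)

/-- The number of ones of `S` to the left of `x` in the row of `x`. -/
def rowRank (S : Finset (α × β)) (x : α × β) : ℕ :=
  (S.filter fun z => z.1 = x.1 ∧ z.2 < x.2).card

theorem exists_between_of_rowRank {S : Finset (α × β)} {a : α} {b c : β} (hbc : b < c)
    (h : rowRank S (a, b) + 1 < rowRank S (a, c)) : ∃ y, b < y ∧ y < c ∧ (a, y) ∈ S := by
  by_contra! hno
  have : (S.filter fun z => z.1 = a ∧ z.2 < c) ⊆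
      insert (a, b) (S.filter fun z => z.1 = a ∧ z.2 < b) := by
    rintro ⟨u, v⟩ hz
    simp only [Finset.mem_filter, Finset.mem_insert, Prod.mk.injEq] at hz ⊢
    obtain ⟨hz, rfl, hv⟩ := hz
    rcases lt_trichotomy v b with hvb | rfl | hvb
    · exact Or.inr ⟨hz, rfl, hvb⟩
    · exact Or.inl ⟨rfl, rfl⟩
    · exact absurd hz (hno v hvb hv)
  have h2 := (Finset.card_le_card this).trans (Finset.card_insert_le _ _)
  unfold rowRank at h
  simp only at h
  omega

theorem rowRank_lt {S : Finset (α × β)} {a : α} {b c : β} (hbc : b < c) (hb : (a, b) ∈ S) :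
    rowRank S (a, b) < rowRank S (a, c) := by
  refine Finset.card_lt_card (Finset.ssubset_iff_of_subset ?_ |>.2 ⟨(a, b), ?_, ?_⟩)
  · intro z hz
    rw [Finset.mem_filter] at hz ⊢
    exact ⟨hz.1, hz.2.1, hz.2.2.trans hbc⟩
  · simp [hb, hbc]
  · simp

/-- Colour each one by the parity of its rank in its row. Two ones of equal colour in a row have
another one of S between them, so a monochromatic copy of Q would extend to the new column. Both
colour classes therefore avoid Q, which doubles the constant. -/
theorem LinearPattern.insert_between {Q : Finset (γ × δ)} (h : LinearPattern Q) {i : γ}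
    {j j₁ j₂ : δ} (h₁ : (i, j₁) ∈ Q) (h₂ : (i, j₂) ∈ Q) (hj₁ : j₁ < j) (hj₂ : j < j₂)
    (hQ : ∀ x ∈ Q, x.2 ≤ j₁ ∨ j₂ ≤ x.2) : LinearPattern (insert (i, j) Q) := by
  classical
  obtain ⟨C, hC⟩ := h
  refine ⟨2 * C, fun S hS => ?_⟩
  have key : ∀ t : ℕ, ¬ Embeds (S.filter fun x => rowRank S x % 2 = t) Q := by
    rintro t ⟨f, g, hf, hg, h⟩
    have hm : ∀ x ∈ Q, (x.2 ∈ Prod.snd '' (Q : Set (γ × δ))) := fun x hx => ⟨x, hx, rfl⟩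
    have e1 := Finset.mem_filter.1 (h _ h₁)
    have e2 := Finset.mem_filter.1 (h _ h₂)
    have hlt : g j₁ < g j₂ := hg (hm _ h₁) (hm _ h₂) (hj₁.trans hj₂)
    have hr : rowRank S (f i, g j₁) < rowRank S (f i, g j₂) := rowRank_lt hlt e1.1
    have p1 : rowRank S (f i, g j₁) % 2 = t := e1.2
    have p2 : rowRank S (f i, g j₂) % 2 = t := e2.2
    obtain ⟨y, hy1, hy2, hy⟩ := exists_between_of_rowRank (S := S) (a := f i) hlt (by omega)
    refine hS (Embeds.insert_col hf hg h (Finset.filter_subset _ _) ⟨_, h₁, rfl⟩ hy ?_ ?_ ?_)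
    · intro x hx hxj
      rcases hQ x hx with h | h
      · exact lt_of_le_of_lt (hg.monotoneOn (hm _ hx) (hm _ h₁) h) hy1
      · exact absurd (hj₂.trans_le h) hxj.not_gt
    · intro x hx hxj
      rcases hQ x hx with h | h
      · exact absurd (h.trans_lt hj₁) hxj.not_gt
      · exact lt_of_lt_of_le hy2 (hg.monotoneOn (hm _ h₂) (hm _ hx) h)
    · rintro x hx rfl
      rcases hQ x hx with h | h
      · exact absurd hj₁ h.not_gt
      · exact absurd hj₂ h.not_gt
  have h0 := hC _ (key 0)
  have h1 := hC _ (key 1)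
  have l0 := Nat.mul_le_mul_left C (lines_mono (Finset.filter_subset
    (fun x => rowRank S x % 2 = 0) S))
  have l1 := Nat.mul_le_mul_left C (lines_mono (Finset.filter_subset
    (fun x => rowRank S x % 2 = 1) S))
  have hs := Finset.card_filter_add_card_filter_not (s := S) (fun x => rowRank S x % 2 = 0)
  have e : S.filter (fun x => ¬ rowRank S x % 2 = 0) = S.filter fun x => rowRank S x % 2 = 1 := by
    ext x; simp
  rw [e] at hs
  rw [mul_assoc]
  omega

/-- Delete the last one of every row, at most one per occupied row. Every remaining one has a one to
its right, so a copy of Q among them would extend; the constant grows by 1. -/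
theorem LinearPattern.insert_last {Q : Finset (γ × δ)} (h : LinearPattern Q) {i : γ}
    {j j₁ : δ} (h₁ : (i, j₁) ∈ Q) (hj₁ : j₁ < j)
    (hQ : ∀ x ∈ Q, x.2 ≤ j₁) : LinearPattern (insert (i, j) Q) := by
  classical
  obtain ⟨C, hC⟩ := h
  refine ⟨C + 1, fun S hS => ?_⟩
  have key : ¬ Embeds (S.filter fun x => ∃ y, x.2 < y ∧ (x.1, y) ∈ S) Q := by
    rintro ⟨f, g, hf, hg, h⟩
    have hm : ∀ x ∈ Q, (x.2 ∈ Prod.snd '' (Q : Set (γ × δ))) := fun x hx => ⟨x, hx, rfl⟩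
    obtain ⟨e1, y, hy1, hy⟩ := Finset.mem_filter.1 (h _ h₁)
    refine hS (Embeds.insert_col hf hg h (Finset.filter_subset _ _) ⟨_, h₁, rfl⟩ hy ?_ ?_ ?_)
    · intro x hx hxj
      exact lt_of_le_of_lt (hg.monotoneOn (hm _ hx) (hm _ h₁) (hQ x hx)) hy1
    · intro x hx hxj
      exact absurd ((hQ x hx).trans_lt hj₁) hxj.not_gt
    · rintro x hx rfl
      exact absurd hj₁ (hQ x hx).not_gt
  have h0 := hC _ key
  have l0 := Nat.mul_le_mul_left C (lines_mono (Finset.filter_subset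
    (fun x => ∃ y, x.2 < y ∧ (x.1, y) ∈ S) S))
  have hs := Finset.card_filter_add_card_filter_not (s := S)
    (fun x => ∃ y, x.2 < y ∧ (x.1, y) ∈ S)
  have h1 : (S.filter fun x => ¬ ∃ y, x.2 < y ∧ (x.1, y) ∈ S).card ≤ (S.image Prod.fst).card := by
    refine Finset.card_le_card_of_injOn Prod.fst ?_ ?_
    · intro x hx
      exact Finset.mem_coe.2 (Finset.mem_image_of_mem _ (Finset.mem_filter.1 hx).1)
    · rintro ⟨a, b⟩ hx ⟨a', b'⟩ hy (rfl : a = a')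
      obtain ⟨hx1, hx⟩ := Finset.mem_filter.1 (Finset.mem_coe.1 hx)
      obtain ⟨hy1, hy⟩ := Finset.mem_filter.1 (Finset.mem_coe.1 hy)
      push Not at hx hy
      rcases lt_trichotomy b b' with hb | rfl | hb
      · exact absurd hy1 (hx _ hb)
      · rfl
      · exact absurd hx1 (hy _ hb)
  have h2 : (S.image Prod.fst).card ≤ lines S := Nat.le_add_right _ _
  rw [add_mul, one_mul]
  omega

/-- Mirror image of `insert_last`: the first one of every row is deleted. -/
theorem LinearPattern.insert_first {Q : Finset (γ × δ)} (h : LinearPattern Q) {i : γ}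
    {j j₁ : δ} (h₁ : (i, j₁) ∈ Q) (hj₁ : j < j₁)
    (hQ : ∀ x ∈ Q, j₁ ≤ x.2) : LinearPattern (insert (i, j) Q) := by
  classical
  obtain ⟨C, hC⟩ := h
  refine ⟨C + 1, fun S hS => ?_⟩
  have key : ¬ Embeds (S.filter fun x => ∃ y, y < x.2 ∧ (x.1, y) ∈ S) Q := by
    rintro ⟨f, g, hf, hg, h⟩
    have hm : ∀ x ∈ Q, (x.2 ∈ Prod.snd '' (Q : Set (γ × δ))) := fun x hx => ⟨x, hx, rfl⟩
    obtain ⟨e1, y, hy1, hy⟩ := Finset.mem_filter.1 (h _ h₁)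
    refine hS (Embeds.insert_col hf hg h (Finset.filter_subset _ _) ⟨_, h₁, rfl⟩ hy ?_ ?_ ?_)
    · intro x hx hxj
      exact absurd (hj₁.trans_le (hQ x hx)) hxj.not_gt
    · intro x hx hxj
      exact lt_of_lt_of_le hy1 (hg.monotoneOn (hm _ h₁) (hm _ hx) (hQ x hx))
    · rintro x hx rfl
      exact absurd hj₁ (hQ x hx).not_gt
  have h0 := hC _ key
  have l0 := Nat.mul_le_mul_left C (lines_mono (Finset.filter_subset
    (fun x => ∃ y, y < x.2 ∧ (x.1, y) ∈ S) S))
  have hs := Finset.card_filter_add_card_filter_not (s := S)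
    (fun x => ∃ y, y < x.2 ∧ (x.1, y) ∈ S)
  have h1 : (S.filter fun x => ¬ ∃ y, y < x.2 ∧ (x.1, y) ∈ S).card ≤ (S.image Prod.fst).card := by
    refine Finset.card_le_card_of_injOn Prod.fst ?_ ?_
    · intro x hx
      exact Finset.mem_coe.2 (Finset.mem_image_of_mem _ (Finset.mem_filter.1 hx).1)
    · rintro ⟨a, b⟩ hx ⟨a', b'⟩ hy (rfl : a = a')
      obtain ⟨hx1, hx⟩ := Finset.mem_filter.1 (Finset.mem_coe.1 hx)
      obtain ⟨hy1, hy⟩ := Finset.mem_filter.1 (Finset.mem_coe.1 hy)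
      push Not at hx hy
      rcases lt_trichotomy b b' with hb | rfl | hb
      · exact absurd hx1 (hy _ hb)
      · rfl
      · exact absurd hy1 (hx _ hb)
  have h2 : (S.image Prod.fst).card ≤ lines S := Nat.le_add_right _ _
  rw [add_mul, one_mul]
  omega

end Basic

/-! ### A recursive matrix with superlinearly many ones, of the form `[[I, A], [A, 0]]` -/

/-- The matrices `A (m + 1) = [[I, A m], [A m, 0]]` as sets of ones. -/
def doubling : ℕ → Finset (ℕ × ℕ)
  | 0 => {(0, 0)}
  | m + 1 => ((Finset.range (2 ^ m)).image fun x => (x, x)) ∪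
      (((doubling m).image fun p => (p.1, p.2 + 2 ^ m)) ∪
        (doubling m).image fun p => (p.1 + 2 ^ m, p.2))

theorem doubling_lt (m : ℕ) : ∀ p ∈ doubling m, p.1 < 2 ^ m ∧ p.2 < 2 ^ m := by
  induction m with
  | zero => simp [doubling]
  | succ m ih =>
    intro p hp
    simp only [doubling, Finset.mem_union, Finset.mem_image, Finset.mem_range] at hp
    have h2 : 2 ^ (m + 1) = 2 * 2 ^ m := pow_succ' 2 m
    rcases hp with ⟨x, hx, rfl⟩ | ⟨x, hx, rfl⟩ | ⟨x, hx, rfl⟩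
    · simp only; omega
    · have := ih x hx; simp only; omega
    · have := ih x hx; simp only; omega

theorem mem_doubling_succ {m x y : ℕ} (h : (x, y) ∈ doubling (m + 1)) :
    (x < 2 ^ m ∧ y < 2 ^ m ∧ x = y) ∨
    (x < 2 ^ m ∧ 2 ^ m ≤ y ∧ (x, y - 2 ^ m) ∈ doubling m) ∨
    (2 ^ m ≤ x ∧ y < 2 ^ m ∧ (x - 2 ^ m, y) ∈ doubling m) := by
  simp only [doubling, Finset.mem_union, Finset.mem_image, Finset.mem_range, Prod.mk.injEq] at h
  rcases h with ⟨z, hz, rfl, rfl⟩ | ⟨⟨u, v⟩, hx, rfl, rfl⟩ | ⟨⟨u, v⟩, hx, rfl, rfl⟩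
  · exact Or.inl ⟨hz, hz, rfl⟩
  · have := doubling_lt m _ hx
    exact Or.inr (Or.inl ⟨this.1, Nat.le_add_left _ _, by simpa using hx⟩)
  · have := doubling_lt m _ hx
    exact Or.inr (Or.inr ⟨Nat.le_add_left _ _, this.2, by simpa using hx⟩)

/-- The two rows and the column b cannot lie in different blocks: if (r, b) is on the diagonal
block, then r' is in the lower half, which forces d and hence a into the left half, where row r has
only its diagonal one. So all four ones lie in one copy of the smaller matrix. -/
theorem doubling_avoids (m : ℕ) : ∀ r r' b a d : ℕ, r < r' → b < a → a ≤ d →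
    (r, b) ∈ doubling m → (r, a) ∈ doubling m → (r', b) ∈ doubling m → (r', d) ∈ doubling m →
    False := by
  induction m with
  | zero =>
    intro r r' b a d hr _ _ h1 _ h3 _
    simp only [doubling, Finset.mem_singleton, Prod.mk.injEq] at h1 h3
    omega
  | succ m ih =>
    intro r r' b a d hr hb ha h1 h2 h3 h4
    rcases mem_doubling_succ h1 with h1 | h1 | h1 <;>
    rcases mem_doubling_succ h3 with h3 | h3 | h3 <;> try omega
    · rcases mem_doubling_succ h2 with h2 | h2 | h2 <;>
      rcases mem_doubling_succ h4 with h4 | h4 | h4 <;> omega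
    · rcases mem_doubling_succ h2 with h2 | h2 | h2 <;> try omega
      rcases mem_doubling_succ h4 with h4 | h4 | h4 <;> try omega
      exact ih _ _ _ (a - 2 ^ m) (d - 2 ^ m) hr (by omega) (by omega) h1.2.2 h2.2.2 h3.2.2 h4.2.2
    · rcases mem_doubling_succ h2 with h2 | h2 | h2 <;> try omega
      rcases mem_doubling_succ h4 with h4 | h4 | h4 <;> try omega
      exact ih (r - 2 ^ m) (r' - 2 ^ m) _ a d (by omega) hb ha h1.2.2 h2.2.2 h3.2.2 h4.2.2

theorem card_doubling (m : ℕ) : (m + 2) * 2 ^ m ≤ 2 * (doubling m).card := by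
  induction m with
  | zero => simp [doubling]
  | succ m ih =>
    have e : (doubling (m + 1)).card = 2 ^ m + ((doubling m).card + (doubling m).card) := by
      rw [doubling, Finset.card_union_of_disjoint, Finset.card_union_of_disjoint,
        Finset.card_image_of_injective, Finset.card_image_of_injective,
        Finset.card_image_of_injective, Finset.card_range]
      · rintro ⟨a, b⟩ ⟨c, d⟩ h
        simpa using h
      · rintro ⟨a, b⟩ ⟨c, d⟩ h
        simpa using h
      · intro a b h
        simpa using h
      · rw [Finset.disjoint_left]
        rintro ⟨x, y⟩ h h'
        simp only [Finset.mem_image, Prod.mk.injEq] at h h'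
        obtain ⟨p, hp, rfl, rfl⟩ := h
        obtain ⟨q, hq, h1, h2⟩ := h'
        have := doubling_lt m _ hp
        omega
      · rw [Finset.disjoint_left]
        rintro ⟨x, y⟩ h h'
        simp only [Finset.mem_image, Finset.mem_union, Finset.mem_range, Prod.mk.injEq] at h h'
        obtain ⟨p, hp, rfl, rfl⟩ := h
        rcases h' with ⟨q, hq, h1, h2⟩ | ⟨q, hq, h1, h2⟩ <;> omega
    rw [e, pow_succ]
    nlinarith

theorem lines_doubling (m : ℕ) : lines (doubling m) ≤ 2 * 2 ^ m := by
  have h1 : ((doubling m).image Prod.fst) ⊆ Finset.range (2 ^ m) := by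
    intro x hx
    obtain ⟨p, hp, rfl⟩ := Finset.mem_image.1 hx
    exact Finset.mem_range.2 (doubling_lt m p hp).1
  have h2 : ((doubling m).image Prod.snd) ⊆ Finset.range (2 ^ m) := by
    intro x hx
    obtain ⟨p, hp, rfl⟩ := Finset.mem_image.1 hx
    exact Finset.mem_range.2 (doubling_lt m p hp).2
  have h1 := Finset.card_le_card h1
  have h2 := Finset.card_le_card h2
  rw [Finset.card_range] at h1 h2
  unfold lines
  omega

/-! ### Forks are non-linear. -/

section

variable {γ δ : Type} [LinearOrder γ] [LinearOrder δ]

theorem lines_image_toDual {α β : Type} [LinearOrder α] [LinearOrder β] (S : Finset (α × β)) :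
    lines (S.image (Prod.map (OrderDual.toDual (α := α)) (id : β → β))) ≤ lines S :=
  lines_image_le (α' := αᵒᵈ) (β' := β) S _ _

theorem card_image_toDual {α β : Type} [LinearOrder α] [LinearOrder β] (S : Finset (α × β)) :
    (S.image (Prod.map (OrderDual.toDual (α := α)) (id : β → β))).card = S.card :=
  Finset.card_image_of_injective _ (Function.Injective.prodMap OrderDual.toDual.injective
    Function.injective_id)

theorem mem_image_toDual {α β : Type} [LinearOrder α] [LinearOrder β] {S : Finset (α × β)}
    {x : αᵒᵈ} {y : β} (h : (x, y) ∈ S.image (Prod.map OrderDual.toDual id)) :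
    (OrderDual.ofDual x, y) ∈ S := by
  obtain ⟨⟨u, v⟩, hp, h⟩ := Finset.mem_image.1 h
  simp only [Prod.map, Prod.mk.injEq, id] at h
  obtain ⟨rfl, rfl⟩ := h
  exact hp

theorem not_linearPattern_fork_of_le {i i' : γ} {b a d : δ} (hi : i ≠ i') (ha : b < a)
    (hd : a ≤ d) : ¬ LinearPattern ({(i, b), (i, a), (i', b), (i', d)} : Finset (γ × δ)) := by
  intro h
  obtain ⟨C, hC⟩ := h.card_le
  have hbd := ha.trans_le hd
  -- At level m = 4C there are at least (m + 2)2^m / 2 = (2C + 1)2^m ones on at most 2 · 2^m lines,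
  -- which exceeds the bound 2C · 2^m.
  have key : (doubling (4 * C)).card ≤ C * lines (doubling (4 * C)) := by
    rcases lt_or_gt_of_ne hi with hi | hi
    · apply hC
      rintro ⟨f, g, hf, hg, h⟩
      exact doubling_avoids _ (f i) (f i') (g b) (g a) (g d)
        (hf ⟨(i, b), by simp, rfl⟩ ⟨(i', b), by simp, rfl⟩ hi)
        (hg ⟨(i, b), by simp, rfl⟩ ⟨(i, a), by simp, rfl⟩ ha)
        (hg.monotoneOn ⟨(i, a), by simp, rfl⟩ ⟨(i', d), by simp, rfl⟩ hd)
        (h (i, b) (by simp)) (h (i, a) (by simp)) (h (i', b) (by simp)) (h (i', d) (by simp))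
    -- For the opposite order of the two rows the matrix is turned upside down.
    · have := hC _ _ ((doubling (4 * C)).image (Prod.map OrderDual.toDual id)) ?_
      · rw [card_image_toDual] at this
        exact this.trans (Nat.mul_le_mul_left _ (lines_image_toDual _))
      rintro ⟨f, g, hf, hg, h⟩
      have hlt := hf ⟨(i', b), by simp, rfl⟩ ⟨(i, b), by simp, rfl⟩ hi
      exact doubling_avoids _ (OrderDual.ofDual (f i)) (OrderDual.ofDual (f i')) (g b) (g a) (g d)
        hlt
        (hg ⟨(i, b), by simp, rfl⟩ ⟨(i, a), by simp, rfl⟩ ha)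
        (hg.monotoneOn ⟨(i, a), by simp, rfl⟩ ⟨(i', d), by simp, rfl⟩ hd)
        (mem_image_toDual (h (i, b) (by simp))) (mem_image_toDual (h (i, a) (by simp)))
        (mem_image_toDual (h (i', b) (by simp))) (mem_image_toDual (h (i', d) (by simp)))
  have h1 := card_doubling (4 * C)
  have h2 := Nat.mul_le_mul_left C (lines_doubling (4 * C))
  have h3 : 0 < 2 ^ (4 * C) := by positivity
  nlinarith

theorem not_linearPattern_fork {i i' : γ} {b a d : δ} (hi : i ≠ i') (ha : b < a) (hd : b < d) :
    ¬ LinearPattern ({(i, b), (i, a), (i', b), (i', d)} : Finset (γ × δ)) := by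
  rcases le_total a d with h | h
  · exact not_linearPattern_fork_of_le hi ha h
  · have e : ({(i, b), (i, a), (i', b), (i', d)} : Finset (γ × δ)) =
        {(i', b), (i', d), (i, b), (i, a)} := by
      ext x; simp only [Finset.mem_insert, Finset.mem_singleton]; tauto
    rw [e]
    exact not_linearPattern_fork_of_le hi.symm hd h

end

/-! ### Matrices avoiding the alternating pattern -/

/-- A matrix without the alternating pattern, all of whose nonempty columns are long, with a set
`L` of live columns of size exactly `m`; every row has its leftmost one in a live column. -/
structure FanMatrix (k m M : ℕ) where
  /-- the rows -/
  R : Type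
  /-- the columns -/
  C : Type
  [ordR : LinearOrder R]
  [ordC : LinearOrder C]
  /-- the ones -/
  S : Finset (R × C)
  /-- the live columns -/
  L : Finset C
  alt : ∀ a b j₁ j₂ j₃ j₄, a < b → j₁ < j₂ → j₂ < j₃ → j₃ < j₄ →
    (a, j₁) ∈ S → (b, j₂) ∈ S → (a, j₃) ∈ S → (b, j₄) ∈ S → False
  first : ∀ r c c', (r, c) ∈ S → c ∈ L → (r, c') ∈ S → c ≤ c'
  -- Needed for the induction: when a live column c is split into several columns, an alternation
  -- whose first two ones both come from c has exactly this shape before the splitting.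
  fork : ∀ a b c j₃ j₄, c ∈ L → a < b → c < j₃ → j₃ < j₄ →
    (a, c) ∈ S → (b, c) ∈ S → (a, j₃) ∈ S → (b, j₄) ∈ S → False
  le_card_L : M ≤ L.card
  le_row : ∀ x ∈ S, k ≤ (S.filter fun z => z.1 = x.1).card
  card_live : ∀ c ∈ L, (S.filter fun z => z.2 = c).card = m
  le_dead : ∀ x ∈ S, x.2 ∉ L → M ≤ (S.filter fun z => z.2 = x.2).card
  exists_live : ∀ x ∈ S, ∃ c ∈ L, (x.1, c) ∈ S

attribute [instance] FanMatrix.ordR FanMatrix.ordC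

namespace FanMatrix

/-- Disjoint columns. -/
def base (m M : ℕ) : FanMatrix 0 m M where
  R := ℕ ×ₗ ℕ
  C := ℕ
  S := (Finset.range M ×ˢ Finset.range m).image fun p => (toLex p, p.1)
  L := Finset.range M
  alt := by
    intro a b j₁ j₂ j₃ j₄ _ h12 h23 _ h1 _ h3 _
    simp only [Finset.mem_image, Prod.mk.injEq] at h1 h3
    obtain ⟨p, -, rfl, rfl⟩ := h1
    obtain ⟨q, -, h, rfl⟩ := h3
    rw [toLex_inj] at h
    subst h
    omega
  first := by
    intro r c c' h1 _ h3
    simp only [Finset.mem_image, Prod.mk.injEq] at h1 h3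
    obtain ⟨p, -, rfl, rfl⟩ := h1
    obtain ⟨q, -, h, rfl⟩ := h3
    rw [toLex_inj] at h
    subst h
    exact le_rfl
  fork := by
    intro a b c j₃ j₄ _ _ hc _ h1 _ h3 _
    simp only [Finset.mem_image, Prod.mk.injEq] at h1 h3
    obtain ⟨p, -, rfl, rfl⟩ := h1
    obtain ⟨q, -, h, rfl⟩ := h3
    rw [toLex_inj] at h
    subst h
    omega
  le_card_L := by simp
  le_row := fun _ _ => Nat.zero_le _
  card_live := by
    intro c hc
    have : (((Finset.range M ×ˢ Finset.range m).image fun p : ℕ × ℕ => (toLex p, p.1)).filter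
        fun z => z.2 = c) = (Finset.range m).image fun i => (toLex (c, i), c) := by
      ext ⟨x, y⟩
      simp only [Finset.mem_filter, Finset.mem_image, Finset.mem_product, Finset.mem_range,
        Prod.mk.injEq] at hc ⊢
      constructor
      · rintro ⟨⟨⟨u, v⟩, ⟨_, hv⟩, rfl, rfl⟩, rfl⟩
        exact ⟨v, hv, rfl, rfl⟩
      · rintro ⟨v, hv, rfl, rfl⟩
        exact ⟨⟨(c, v), ⟨hc, hv⟩, rfl, rfl⟩, rfl⟩
    rw [this, Finset.card_image_of_injective, Finset.card_range]
    intro x y h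
    simpa using h
  le_dead := by
    intro x hx hL
    obtain ⟨p, hp, rfl⟩ := Finset.mem_image.1 hx
    exact absurd (Finset.mem_product.1 hp).1 hL
  exists_live := by
    intro x hx
    obtain ⟨p, hp, rfl⟩ := Finset.mem_image.1 hx
    exact ⟨_, (Finset.mem_product.1 hp).1, hx⟩

/-- Empty live columns. -/
def empty (k M : ℕ) : FanMatrix k 0 M where
  R := ℕ
  C := ℕ
  S := ∅
  L := Finset.range M
  alt := by simp
  first := by simp
  fork := by simp
  le_card_L := by simp
  le_row := by simp
  card_live := by simp
  le_dead := by simp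
  exists_live := by simp

theorem exists_strictAntiOn_bijOn {α β : Type} [LinearOrder α] [LinearOrder β] {A : Finset α}
    {B : Finset β} (h : A.card = B.card) (hB : B.Nonempty) :
    ∃ φ : α → β, StrictAntiOn φ A ∧ Set.BijOn φ A B := by
  classical
  obtain ⟨b, -⟩ := hB
  let e : A ≃ B := (A.orderIsoOfFin h).symm.toEquiv.trans
    (Fin.revPerm.trans (B.orderIsoOfFin rfl).toEquiv)
  have he : StrictAnti e := by
    intro x y hxy
    simp only [e, Equiv.trans_apply]
    apply (B.orderIsoOfFin rfl).strictMono
    simpa using hxy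
  refine ⟨fun x => if hx : x ∈ A then e ⟨x, hx⟩ else b, ?_, ?_, ?_, ?_⟩
  · intro x hx y hy hxy
    have hx : x ∈ A := hx
    have hy : y ∈ A := hy
    simp only [hx, hy, dif_pos]
    exact he hxy
  · intro x hx
    have hx : x ∈ A := hx
    simp only [hx, dif_pos]
    exact (e ⟨x, hx⟩).2
  · intro x hx y hy hxy
    have hx : x ∈ A := hx
    have hy : y ∈ A := hy
    simp only [hx, hy, dif_pos] at hxy
    simpa using e.injective (Subtype.ext hxy)
  · intro y hy
    refine ⟨e.symm ⟨y, hy⟩, (e.symm ⟨y, hy⟩).2, ?_⟩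
    simp

/-! ### Composition of fan matrices. -/

section Step

variable {k m M : ℕ} (s : FanMatrix (k + 1) m M) (B : FanMatrix k s.L.card M)
  (φ : B.C → B.R → s.C)

/-- Rows of the composition: the rows of `B` above those of the copies of `s`. -/
abbrev StepR : Type := B.R ⊕ₗ (B.C ×ₗ s.R)

/-- Columns of the composition: each column of `B` is preceded by a copy of the columns of `s`. -/
abbrev StepC : Type := B.C ×ₗ WithTop s.C

instance : DecidableEq (StepR s B) := LinearOrder.toDecidableEq

instance : DecidableEq (StepC s B) := LinearOrder.toDecidableEq

/-- The ones of the composition. -/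
def stepS : Finset (StepR s B × StepC s B) :=
  -- The columns of B reappear as the top columns of their blocks. Each one in a live column of B
  -- gets a second one at `φ` inside its block, and below these rows each live block carries its own
  -- copy of s.
  (B.S.image fun x => (toLex (Sum.inl x.1), toLex (x.2, (⊤ : WithTop s.C)))) ∪
    (((B.S.filter fun x => x.2 ∈ B.L).image fun x =>
      (toLex (Sum.inl x.1), toLex (x.2, ((φ x.2 x.1 : s.C) : WithTop s.C)))) ∪
    ((B.L ×ˢ s.S).image fun p =>
      (toLex (Sum.inr (toLex (p.1, p.2.1))), toLex (p.1, ((p.2.2 : s.C) : WithTop s.C)))))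

/-- The live columns of the composition. -/
def stepL : Finset (StepC s B) :=
  (B.L ×ˢ s.L).image fun p => toLex (p.1, ((p.2 : s.C) : WithTop s.C))

variable {s B φ}

theorem mem_stepS_outer {r : B.R} {c : B.C} {u : WithTop s.C} :
    ((toLex (Sum.inl r), toLex (c, u)) : StepR s B × StepC s B) ∈ stepS s B φ ↔
      (r, c) ∈ B.S ∧ (u = ⊤ ∨ (c ∈ B.L ∧ u = φ c r)) := by
  simp only [stepS, Finset.mem_union, Finset.mem_image, Prod.mk.injEq, toLex_inj, Sum.inl.injEq,
    Finset.mem_filter, Finset.mem_product, reduceCtorEq, false_and, and_false, exists_false,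
    or_false, Prod.exists]
  constructor
  · rintro (⟨a, b, h, rfl, rfl, rfl⟩ | ⟨a, b, ⟨h, hb⟩, rfl, rfl, rfl⟩)
    · exact ⟨h, Or.inl rfl⟩
    · exact ⟨h, Or.inr ⟨hb, rfl⟩⟩
  · rintro ⟨h, rfl | ⟨hc, rfl⟩⟩
    · exact Or.inl ⟨_, _, h, rfl, rfl, rfl⟩
    · exact Or.inr ⟨_, _, ⟨h, hc⟩, rfl, rfl, rfl⟩

theorem mem_stepS_inner {r : s.R} {d c : B.C} {u : WithTop s.C} :
    ((toLex (Sum.inr (toLex (d, r))), toLex (c, u)) : StepR s B × StepC s B) ∈ stepS s B φ ↔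
      d = c ∧ c ∈ B.L ∧ ∃ y : s.C, u = y ∧ (r, y) ∈ s.S := by
  simp only [stepS, Finset.mem_union, Finset.mem_image, Prod.mk.injEq, toLex_inj, Sum.inr.injEq,
    Finset.mem_product, reduceCtorEq, false_and, and_false, exists_false,
    false_or, Prod.exists]
  constructor
  · rintro ⟨a, b, y, ⟨h, h'⟩, ⟨rfl, rfl⟩, rfl, rfl⟩
    exact ⟨rfl, h, _, rfl, h'⟩
  · rintro ⟨rfl, h, y, rfl, h'⟩
    exact ⟨_, _, _, ⟨h, h'⟩, ⟨rfl, rfl⟩, rfl, rfl⟩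

theorem mem_stepL {c : B.C} {u : WithTop s.C} :
    (toLex (c, u) : StepC s B) ∈ stepL s B ↔ c ∈ B.L ∧ ∃ y : s.C, u = y ∧ y ∈ s.L := by
  simp only [stepL, Finset.mem_image, Prod.mk.injEq, toLex_inj, Finset.mem_product, Prod.exists]
  constructor
  · rintro ⟨a, b, ⟨h, h'⟩, rfl, rfl⟩
    exact ⟨h, _, rfl, h'⟩
  · rintro ⟨h, y, rfl, h'⟩
    exact ⟨_, _, ⟨h, h'⟩, rfl, rfl⟩

theorem stepC_lt {c c' : B.C} {u u' : WithTop s.C} :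
    (toLex (c, u) : StepC s B) < toLex (c', u') ↔ c < c' ∨ c = c' ∧ u < u' :=
  Prod.Lex.toLex_lt_toLex

theorem stepC_le_of_lt {c c' : B.C} {u u' : WithTop s.C}
    (h : (toLex (c, u) : StepC s B) < toLex (c', u')) : c ≤ c' := by
  rcases stepC_lt.1 h with h | h
  · exact h.le
  · exact h.1.le

theorem stepR_cases (x : StepR s B) :
    (∃ r, x = toLex (Sum.inl r)) ∨ ∃ d r, x = toLex (Sum.inr (toLex (d, r))) := by
  obtain ⟨x, rfl⟩ := toLex.surjective x
  rcases x with r | x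
  · exact Or.inl ⟨r, rfl⟩
  · obtain ⟨⟨d, r⟩, rfl⟩ := toLex.surjective x
    exact Or.inr ⟨d, r, rfl⟩

theorem stepC_cases (x : StepC s B) : ∃ c u, x = toLex (c, u) := by
  obtain ⟨⟨c, u⟩, rfl⟩ := toLex.surjective x
  exact ⟨c, u, rfl⟩

/-- Two rows of B: the columns of the alternation project to distinct columns of B, contradicting
`B.alt`, or only the first two coincide, contradicting `B.fork`; three in one block are excluded
because `φ` is decreasing. A row of B above a row of a copy: the row of B has at most one one below
the top in that block and, the block being live, none to its left. Two rows of copies: all columns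
lie in one block and `s.alt` applies. -/
theorem step_alt (hanti : ∀ c ∈ B.L, ∀ a b, a < b → (a, c) ∈ B.S → (b, c) ∈ B.S → φ c b < φ c a)
    (a b : StepR s B) (j₁ j₂ j₃ j₄ : StepC s B) (hab : a < b) (h12 : j₁ < j₂) (h23 : j₂ < j₃)
    (h34 : j₃ < j₄) (h1 : (a, j₁) ∈ stepS s B φ) (h2 : (b, j₂) ∈ stepS s B φ)
    (h3 : (a, j₃) ∈ stepS s B φ) (h4 : (b, j₄) ∈ stepS s B φ) : False := by
  obtain ⟨c1, u1, rfl⟩ := stepC_cases j₁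
  obtain ⟨c2, u2, rfl⟩ := stepC_cases j₂
  obtain ⟨c3, u3, rfl⟩ := stepC_cases j₃
  obtain ⟨c4, u4, rfl⟩ := stepC_cases j₄
  have l12 := stepC_le_of_lt h12
  have l23 := stepC_le_of_lt h23
  have l34 := stepC_le_of_lt h34
  rcases stepR_cases a with ⟨a, rfl⟩ | ⟨d, a, rfl⟩ <;>
  rcases stepR_cases b with ⟨b, rfl⟩ | ⟨e, b, rfl⟩
  · rw [Sum.Lex.inl_lt_inl_iff] at hab
    rw [mem_stepS_outer] at h1 h2 h3 h4
    rw [stepC_lt] at h12 h23 h34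
    have live : ∀ {c : B.C} {u v : WithTop s.C} {r : B.R}, u < v → ((r, c) ∈ B.S ∧ (u = ⊤ ∨ (c ∈ B.L ∧ u = φ c r))) →
        c ∈ B.L ∧ u = φ c r := by
      intro c u v r huv h
      rcases h.2 with rfl | h
      · exact absurd huv not_top_lt
      · exact h
    -- A row has its live one leftmost, so if c3 is live, row a has nothing strictly to its left.
    have hno : c3 ∈ B.L → c1 = c3 := fun hL => le_antisymm (l12.trans l23)
      (B.first _ _ _ h3.1 hL h1.1)
    have s34 : c3 < c4 ∨ c1 = c3 := by
      rcases h34 with h | ⟨_, h⟩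
      · exact Or.inl h
      · exact Or.inr (hno (live h h3).1)
    have s23 : c2 < c3 ∨ c1 = c3 := by
      rcases h23 with h | ⟨rfl, h⟩
      · exact Or.inl h
      · exact Or.inr (hno (live h h2).1)
    have s13 : c1 ≠ c3 := by
      rintro rfl
      obtain rfl : c1 = c2 := le_antisymm l12 l23
      have h12 := h12.resolve_left (lt_irrefl _)
      have h23 := h23.resolve_left (lt_irrefl _)
      have e1 := live h12.2 h1
      have e2 := live h23.2 h2
      have := hanti _ e1.1 _ _ hab h1.1 h2.1
      have h := h12.2
      rw [e1.2, e2.2, WithTop.coe_lt_coe] at h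
      exact lt_asymm h this
    have s34 := s34.resolve_right s13
    have s23 := s23.resolve_right s13
    rcases h12 with s12 | ⟨rfl, h⟩
    · exact B.alt a b c1 c2 c3 c4 hab s12 s23 s34 h1.1 h2.1 h3.1 h4.1
    · exact B.fork a b c1 c3 c4 (live h h1).1 hab s23 s34 h1.1 h2.1 h3.1 h4.1
  · rw [mem_stepS_outer] at h1 h3
    rw [mem_stepS_inner] at h2 h4
    obtain ⟨rfl, hL, -⟩ := h2
    obtain ⟨rfl, -, y4, rfl, -⟩ := h4
    obtain rfl := le_antisymm l23 l34
    rw [stepC_lt] at h12 h23 h34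
    replace h23 := (h23.resolve_left (lt_irrefl _)).2
    replace h34 := (h34.resolve_left (lt_irrefl _)).2
    have h3' : u3 = φ e a := by
      rcases h3.2 with rfl | h
      · exact absurd h34 not_top_lt
      · exact h.2
    obtain rfl := le_antisymm l12 (B.first _ _ _ h3.1 hL h1.1)
    have h12 := (h12.resolve_left (lt_irrefl _)).2
    have h13 : u1 < u3 := lt_trans h12 h23
    rcases h1.2 with rfl | h
    · exact absurd h12 not_top_lt
    · rw [h.2, h3'] at h13
      exact lt_irrefl _ h13
  · exact absurd hab Sum.Lex.not_inr_lt_inl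
  · rw [mem_stepS_inner] at h1 h2 h3 h4
    obtain ⟨rfl, -, y1, rfl, h1⟩ := h1
    obtain ⟨rfl, -, y2, rfl, h2⟩ := h2
    obtain ⟨rfl, -, y3, rfl, h3⟩ := h3
    obtain ⟨rfl, -, y4, rfl, h4⟩ := h4
    obtain rfl := le_antisymm l12 l23
    rw [Sum.Lex.inr_lt_inr_iff, Prod.Lex.toLex_lt_toLex] at hab
    rw [stepC_lt] at h12 h23 h34
    have hab := (hab.resolve_left (lt_irrefl _)).2
    have h12 := WithTop.coe_lt_coe.1 (h12.resolve_left (lt_irrefl _)).2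
    have h23 := WithTop.coe_lt_coe.1 (h23.resolve_left (lt_irrefl _)).2
    have h34 := WithTop.coe_lt_coe.1 (h34.resolve_left (lt_irrefl _)).2
    exact s.alt _ _ _ _ _ _ hab h12 h23 h34 h1 h2 h3 h4

theorem step_first (r : StepR s B) (c c' : StepC s B) (h : (r, c) ∈ stepS s B φ)
    (hc : c ∈ stepL s B) (h' : (r, c') ∈ stepS s B φ) : c ≤ c' := by
  obtain ⟨c, u, rfl⟩ := stepC_cases c
  obtain ⟨c', u', rfl⟩ := stepC_cases c'
  replace hc := mem_stepL.1 hc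
  obtain ⟨hc, y, rfl, hy⟩ := hc
  rw [Prod.Lex.toLex_le_toLex]
  simp only
  rcases stepR_cases r with ⟨r, rfl⟩ | ⟨d, r, rfl⟩
  · rw [mem_stepS_outer] at h h'
    rcases (B.first _ _ _ h.1 hc h'.1).lt_or_eq with hlt | rfl
    · exact Or.inl hlt
    · refine Or.inr ⟨rfl, ?_⟩
      have e := (h.2.resolve_left WithTop.coe_ne_top).2
      rcases h'.2 with rfl | h'
      · exact le_top
      · rw [e, h'.2]
  · rw [mem_stepS_inner] at h h'
    obtain ⟨rfl, -, y1, e, h1⟩ := h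
    obtain ⟨rfl, -, y2, rfl, h2⟩ := h'
    obtain rfl := WithTop.coe_injective e
    exact Or.inr ⟨rfl, WithTop.coe_le_coe.2 (s.first _ _ _ h1 hy h2)⟩

/-- A live column of the composition holds at most one one in the rows of B, so two such rows cannot
share it. If only a is a row of B, its only further one in the block is in the top column, to the
right of every one of the copy. Otherwise `s.fork` applies. -/
theorem step_fork (hanti : ∀ c ∈ B.L, ∀ a b, a < b → (a, c) ∈ B.S → (b, c) ∈ B.S → φ c b < φ c a)
    (a b : StepR s B) (c j₃ j₄ : StepC s B) (hc : c ∈ stepL s B) (hab : a < b) (h3 : c < j₃)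
    (h34 : j₃ < j₄) (h1 : (a, c) ∈ stepS s B φ) (h2 : (b, c) ∈ stepS s B φ)
    (h3' : (a, j₃) ∈ stepS s B φ) (h4 : (b, j₄) ∈ stepS s B φ) : False := by
  obtain ⟨c, u, rfl⟩ := stepC_cases c
  obtain ⟨c3, u3, rfl⟩ := stepC_cases j₃
  obtain ⟨c4, u4, rfl⟩ := stepC_cases j₄
  replace hc := mem_stepL.1 hc
  obtain ⟨hc, y, rfl, hy⟩ := hc
  have l3 := stepC_le_of_lt h3
  have l34 := stepC_le_of_lt h34
  rcases stepR_cases a with ⟨a, rfl⟩ | ⟨d, a, rfl⟩ <;>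
  rcases stepR_cases b with ⟨b, rfl⟩ | ⟨e, b, rfl⟩
  · rw [mem_stepS_outer] at h1 h2
    rw [Sum.Lex.inl_lt_inl_iff] at hab
    have e1 := (h1.2.resolve_left WithTop.coe_ne_top).2
    have e2 := (h2.2.resolve_left WithTop.coe_ne_top).2
    have := hanti c hc a b hab h1.1 h2.1
    rw [WithTop.coe_injective (e1.symm.trans e2)] at this
    exact lt_irrefl _ this
  · rw [mem_stepS_outer] at h1 h3'
    rw [mem_stepS_inner] at h2 h4
    obtain ⟨rfl, -, -⟩ := h2
    obtain ⟨rfl, -, y4, rfl, -⟩ := h4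
    obtain rfl := le_antisymm l3 l34
    rw [stepC_lt] at h3 h34
    have h3 := (h3.resolve_left (lt_irrefl _)).2
    have h34 := (h34.resolve_left (lt_irrefl _)).2
    have e1 := (h1.2.resolve_left WithTop.coe_ne_top).2
    rcases h3'.2 with rfl | h
    · exact absurd h34 not_top_lt
    · rw [e1, h.2] at h3
      exact lt_irrefl _ h3
  · exact absurd hab Sum.Lex.not_inr_lt_inl
  · rw [mem_stepS_inner] at h1 h2 h3' h4
    obtain ⟨rfl, -, y1, e1, h1⟩ := h1
    obtain ⟨rfl, -, y2, e2, h2⟩ := h2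
    obtain ⟨rfl, -, y3, rfl, h3'⟩ := h3'
    obtain ⟨rfl, -, y4, rfl, h4⟩ := h4
    obtain rfl := WithTop.coe_injective e1
    obtain rfl := WithTop.coe_injective e2
    rw [Sum.Lex.inr_lt_inr_iff, Prod.Lex.toLex_lt_toLex] at hab
    rw [stepC_lt] at h3 h34
    have hab := (hab.resolve_left (lt_irrefl _)).2
    have h3 := WithTop.coe_lt_coe.1 (h3.resolve_left (lt_irrefl _)).2
    have h34 := WithTop.coe_lt_coe.1 (h34.resolve_left (lt_irrefl _)).2
    exact s.fork _ _ _ _ _ hy hab h3 h34 h1 h2 h3' h4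

theorem step_le_card_L (hM : 1 ≤ M) : M ≤ (stepL s B).card := by
  rw [stepL, Finset.card_image_of_injective, Finset.card_product]
  · exact (Nat.le_mul_of_pos_right _ (hM.trans s.le_card_L)).trans
      (Nat.mul_le_mul_right _ B.le_card_L)
  · rintro ⟨a, b⟩ ⟨c, d⟩ h
    simpa using h

/-- A row of B keeps its ones, moved to top columns, and gains one at `φ` in its live block; rows of
copies already have enough. -/
theorem step_le_row (x : StepR s B × StepC s B) (hx : x ∈ stepS s B φ) :
    k + 1 ≤ ((stepS s B φ).filter fun z => z.1 = x.1).card := by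
  obtain ⟨r, c⟩ := x
  obtain ⟨c, u, rfl⟩ := stepC_cases c
  rcases stepR_cases r with ⟨r, rfl⟩ | ⟨d, r, rfl⟩
  · rw [mem_stepS_outer] at hx
    obtain ⟨c₀, hc₀, h₀⟩ := B.exists_live _ hx.1
    have hinj : Function.Injective fun x : B.R × B.C =>
        ((toLex (Sum.inl x.1), toLex (x.2, (⊤ : WithTop s.C))) : StepR s B × StepC s B) := by
      rintro ⟨a, b⟩ ⟨c, d⟩ h
      simpa using h
    have hsub : insert ((toLex (Sum.inl r), toLex (c₀, ((φ c₀ r : s.C) : WithTop s.C))) :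
        StepR s B × StepC s B) ((B.S.filter fun z => z.1 = r).image fun x =>
          (toLex (Sum.inl x.1), toLex (x.2, (⊤ : WithTop s.C)))) ⊆
        (stepS s B φ).filter fun z => z.1 = toLex (Sum.inl r) := by
      intro z hz
      rcases Finset.mem_insert.1 hz with rfl | hz
      · exact Finset.mem_filter.2 ⟨mem_stepS_outer.2 ⟨h₀, Or.inr ⟨hc₀, rfl⟩⟩, rfl⟩
      · obtain ⟨⟨r', c'⟩, hw, rfl⟩ := Finset.mem_image.1 hz
        replace hw := Finset.mem_filter.1 hw
        obtain ⟨hw, rfl⟩ := hw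
        exact Finset.mem_filter.2 ⟨mem_stepS_outer.2 ⟨hw, Or.inl rfl⟩, rfl⟩
    refine le_trans ?_ (Finset.card_le_card hsub)
    rw [Finset.card_insert_of_notMem, Finset.card_image_of_injective _ hinj]
    · exact Nat.succ_le_succ (B.le_row _ hx.1)
    · simp
  · obtain ⟨rfl, hc, y, rfl, hy⟩ := mem_stepS_inner.1 hx
    have hinj : Function.Injective fun x : s.R × s.C =>
        ((toLex (Sum.inr (toLex (d, x.1))), toLex (d, (x.2 : WithTop s.C))) :
          StepR s B × StepC s B) := by
      rintro ⟨a, b⟩ ⟨c, d⟩ h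
      simpa using h
    refine (s.le_row _ hy).trans ?_
    rw [← Finset.card_image_of_injective _ hinj]
    refine Finset.card_le_card ?_
    intro z hz
    obtain ⟨⟨r', c'⟩, hw, rfl⟩ := Finset.mem_image.1 hz
    replace hw := Finset.mem_filter.1 hw
    obtain ⟨hw, rfl⟩ := hw
    exact Finset.mem_filter.2 ⟨mem_stepS_inner.2 ⟨rfl, hc, _, rfl, hw⟩, rfl⟩

theorem inner_col_injective (c : B.C) : Function.Injective fun x : s.R × s.C =>
    ((toLex (Sum.inr (toLex (c, x.1))), toLex (c, (x.2 : WithTop s.C))) :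
      StepR s B × StepC s B) := by
  rintro ⟨a, b⟩ ⟨c, d⟩ h
  simpa using h

/-- `φ` is a bijection onto the live columns of s, so each of them gains exactly one new one. -/
theorem step_card_live
    (hbij : ∀ c ∈ B.L, Set.BijOn (φ c) {r | (r, c) ∈ B.S} s.L)
    (c : StepC s B) (hc : c ∈ stepL s B) :
    ((stepS s B φ).filter fun z => z.2 = c).card = m + 1 := by
  obtain ⟨c, u, rfl⟩ := stepC_cases c
  replace hc := mem_stepL.1 hc
  obtain ⟨hc, y, rfl, hy⟩ := hc
  obtain ⟨r₀, hr₀, hφ⟩ := (hbij c hc).surjOn hy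
  have e : ((stepS s B φ).filter fun z => z.2 = toLex (c, (y : WithTop s.C))) =
      insert ((toLex (Sum.inl r₀), toLex (c, (y : WithTop s.C))) : StepR s B × StepC s B)
        ((s.S.filter fun z => z.2 = y).image fun x =>
          (toLex (Sum.inr (toLex (c, x.1))), toLex (c, (x.2 : WithTop s.C)))) := by
    ext ⟨r, c'⟩
    rw [Finset.mem_filter, Finset.mem_insert, Finset.mem_image]
    constructor
    · rintro ⟨h, rfl⟩
      rcases stepR_cases r with ⟨r, rfl⟩ | ⟨d, r, rfl⟩
      · left
        rw [mem_stepS_outer] at h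
        have h2 := WithTop.coe_injective (h.2.resolve_left WithTop.coe_ne_top).2
        rw [(hbij c hc).injOn hr₀ h.1 (hφ.trans h2)]
      · right
        obtain ⟨rfl, -, y', e, h⟩ := mem_stepS_inner.1 h
        obtain rfl := WithTop.coe_injective e
        exact ⟨(r, y), Finset.mem_filter.2 ⟨h, rfl⟩, rfl⟩
    · rintro (h | ⟨⟨r', y'⟩, hw, h⟩)
      · rw [Prod.mk.injEq] at h
        obtain ⟨rfl, rfl⟩ := h
        exact ⟨mem_stepS_outer.2 ⟨hr₀, Or.inr ⟨hc, by rw [hφ]⟩⟩, rfl⟩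
      · replace hw := Finset.mem_filter.1 hw
        obtain ⟨hw, rfl⟩ := hw
        rw [Prod.mk.injEq] at h
        obtain ⟨rfl, rfl⟩ := h
        exact ⟨mem_stepS_inner.2 ⟨rfl, hc, _, rfl, hw⟩, rfl⟩
  rw [e, Finset.card_insert_of_notMem, Finset.card_image_of_injective _ (inner_col_injective c),
    s.card_live y hy]
  simp

theorem step_le_dead (hmaps : ∀ c ∈ B.L, ∀ r, (r, c) ∈ B.S → φ c r ∈ s.L)
    (x : StepR s B × StepC s B) (hx : x ∈ stepS s B φ) (hL : x.2 ∉ stepL s B) :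
    M ≤ ((stepS s B φ).filter fun z => z.2 = x.2).card := by
  obtain ⟨r, c⟩ := x
  obtain ⟨c, u, rfl⟩ := stepC_cases c
  rcases stepR_cases r with ⟨r, rfl⟩ | ⟨d, r, rfl⟩
  · replace hx := mem_stepS_outer.1 hx
    obtain ⟨hx, rfl | ⟨hc, rfl⟩⟩ := hx
    · have hinj : Function.Injective fun x : B.R × B.C =>
          ((toLex (Sum.inl x.1), toLex (x.2, (⊤ : WithTop s.C))) : StepR s B × StepC s B) := by
        rintro ⟨a, b⟩ ⟨c, d⟩ h
        simpa using h
      have h : M ≤ (B.S.filter fun z => z.2 = c).card := by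
        -- A formerly live column of B is dead now, but it has `s.L.card` ≥ M ones.
        by_cases hc : c ∈ B.L
        · rw [B.card_live c hc]
          exact s.le_card_L
        · exact B.le_dead (r, c) hx hc
      refine h.trans ?_
      rw [← Finset.card_image_of_injective _ hinj]
      refine Finset.card_le_card ?_
      intro z hz
      obtain ⟨⟨r', c'⟩, hw, rfl⟩ := Finset.mem_image.1 hz
      replace hw := Finset.mem_filter.1 hw
      obtain ⟨hw, rfl⟩ := hw
      exact Finset.mem_filter.2 ⟨mem_stepS_outer.2 ⟨hw, Or.inl rfl⟩, rfl⟩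
    · exact absurd (mem_stepL.2 ⟨hc, _, rfl, hmaps c hc r hx⟩) hL
  · obtain ⟨rfl, hc, y, rfl, hy⟩ := mem_stepS_inner.1 hx
    have hyL : y ∉ s.L := fun h => hL (mem_stepL.2 ⟨hc, y, rfl, h⟩)
    refine (s.le_dead _ hy hyL).trans ?_
    rw [← Finset.card_image_of_injective _ (inner_col_injective (B := B) d)]
    refine Finset.card_le_card ?_
    intro z hz
    obtain ⟨⟨r', c'⟩, hw, rfl⟩ := Finset.mem_image.1 hz
    replace hw := Finset.mem_filter.1 hw
    obtain ⟨hw, rfl⟩ := hw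
    exact Finset.mem_filter.2 ⟨mem_stepS_inner.2 ⟨rfl, hc, _, rfl, hw⟩, rfl⟩

theorem step_exists_live (hmaps : ∀ c ∈ B.L, ∀ r, (r, c) ∈ B.S → φ c r ∈ s.L)
    (x : StepR s B × StepC s B) (hx : x ∈ stepS s B φ) :
    ∃ c ∈ stepL s B, (x.1, c) ∈ stepS s B φ := by
  obtain ⟨r, c⟩ := x
  obtain ⟨c, u, rfl⟩ := stepC_cases c
  rcases stepR_cases r with ⟨r, rfl⟩ | ⟨d, r, rfl⟩
  · rw [mem_stepS_outer] at hx
    obtain ⟨c₀, hc₀, h₀⟩ := B.exists_live _ hx.1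
    exact ⟨toLex (c₀, (φ c₀ r : s.C)), mem_stepL.2 ⟨hc₀, _, rfl, hmaps _ hc₀ _ h₀⟩,
      mem_stepS_outer.2 ⟨h₀, Or.inr ⟨hc₀, rfl⟩⟩⟩
  · obtain ⟨rfl, hc, y, rfl, hy⟩ := mem_stepS_inner.1 hx
    obtain ⟨y₀, hy₀, h₀⟩ := s.exists_live _ hy
    exact ⟨toLex (d, (y₀ : s.C)), mem_stepL.2 ⟨hc, _, rfl, hy₀⟩,
      mem_stepS_inner.2 ⟨rfl, hc, _, rfl, h₀⟩⟩

end Step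

theorem nonempty_step {k m M : ℕ} (hM : 1 ≤ M) (s : FanMatrix (k + 1) m M)
    (B : FanMatrix k s.L.card M) : Nonempty (FanMatrix (k + 1) (m + 1) M) := by
  have hsL : s.L.Nonempty := Finset.card_pos.1 (hM.trans s.le_card_L)
  have hcol : ∀ c : B.C, ∃ φ : B.R → s.C, c ∈ B.L →
      StrictAntiOn φ {r | (r, c) ∈ B.S} ∧ Set.BijOn φ {r | (r, c) ∈ B.S} s.L := by
    intro c
    by_cases hc : c ∈ B.L
    · have hcard : ((B.S.filter fun z => z.2 = c).image Prod.fst).card = s.L.card := by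
        refine Eq.trans ?_ (B.card_live c hc)
        refine Finset.card_image_of_injOn ?_
        rintro ⟨a, b⟩ hx ⟨a', b'⟩ hy h
        have h1 : b = c := (Finset.mem_filter.1 (Finset.mem_coe.1 hx)).2
        have h2 : b' = c := (Finset.mem_filter.1 (Finset.mem_coe.1 hy)).2
        exact Prod.ext h (h1.trans h2.symm)
      obtain ⟨φ, h1, h2⟩ := exists_strictAntiOn_bijOn hcard hsL
      have e : (((B.S.filter fun z => z.2 = c).image Prod.fst : Finset B.R) : Set B.R) =
          {r | (r, c) ∈ B.S} := by
        ext r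
        simp
      rw [e] at h1 h2
      exact ⟨φ, fun _ => ⟨h1, h2⟩⟩
    · exact ⟨fun _ => hsL.choose, fun h => absurd h hc⟩
  choose φ hφ using hcol
  have hanti : ∀ c ∈ B.L, ∀ a b, a < b → (a, c) ∈ B.S → (b, c) ∈ B.S → φ c b < φ c a :=
    fun c hc a b hab ha hb => (hφ c hc).1 ha hb hab
  have hmaps : ∀ c ∈ B.L, ∀ r, (r, c) ∈ B.S → φ c r ∈ s.L :=
    fun c hc r hr => (hφ c hc).2.mapsTo hr
  exact ⟨{
    R := StepR s B
    C := StepC s B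
    S := stepS s B φ
    L := stepL s B
    alt := step_alt hanti
    first := step_first
    fork := step_fork hanti
    le_card_L := step_le_card_L hM
    le_row := step_le_row
    card_live := step_card_live fun c hc => (hφ c hc).2
    le_dead := step_le_dead hmaps
    exists_live := step_exists_live hmaps }⟩

/-- Double induction of Ackermann type: the column size required of B is the number of live columns
of s, known only once s is built, so the induction on k must allow every m. -/
theorem nonempty {M : ℕ} (hM : 1 ≤ M) (k m : ℕ) : Nonempty (FanMatrix k m M) := by
  induction k generalizing m with
  | zero => exact ⟨base m M⟩
  | succ k ihk =>
    induction m with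
    | zero => exact ⟨empty _ M⟩
    | succ m ihm =>
      obtain ⟨s⟩ := ihm
      obtain ⟨B⟩ := ihk s.L.card
      exact nonempty_step hM s B

theorem mul_lines_le {M : ℕ} (A : FanMatrix M M M) : M * lines A.S ≤ 2 * A.S.card := by
  have h1 : M * (A.S.image Prod.fst).card ≤ A.S.card := by
    refine Finset.mul_card_image_le_card A.S M ?_
    intro r hr
    obtain ⟨x, hx, rfl⟩ := Finset.mem_image.1 hr
    exact A.le_row x hx
  have h2 : M * (A.S.image Prod.snd).card ≤ A.S.card := by
    refine Finset.mul_card_image_le_card A.S M ?_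
    intro c hc
    obtain ⟨x, hx, rfl⟩ := Finset.mem_image.1 hc
    by_cases hL : x.2 ∈ A.L
    · exact (A.card_live _ hL).ge
    · exact A.le_dead x hx hL
  unfold lines
  nlinarith

end FanMatrix

/-! ### Alternations are non-linear; minimal patterns. -/

section

variable {γ δ : Type} [LinearOrder γ] [LinearOrder δ]

theorem not_linearPattern_alternation {a b : γ} {j₁ j₂ j₃ j₄ : δ} (hab : a ≠ b) (h12 : j₁ < j₂)
    (h23 : j₂ < j₃) (h34 : j₃ < j₄) :
    ¬ LinearPattern ({(a, j₁), (b, j₂), (a, j₃), (b, j₄)} : Finset (γ × δ)) := by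
  intro h
  obtain ⟨C, hC⟩ := h.card_le
  -- With M = 2C + 1, `mul_lines_le` gives (2C + 1) · lines ≤ 2 · ones, whereas linearity gives 2 ·
  -- ones ≤ 2C · lines. Together they leave no lines and no ones, against the nonempty live columns.
  obtain ⟨A⟩ := FanMatrix.nonempty (M := 2 * C + 1) (by omega) (2 * C + 1) (2 * C + 1)
  have key : A.S.card ≤ C * lines A.S := by
    rcases lt_or_gt_of_ne hab with hi | hi
    · apply hC
      rintro ⟨f, g, hf, hg, h⟩
      exact A.alt (f a) (f b) (g j₁) (g j₂) (g j₃) (g j₄)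
        (hf ⟨(a, j₁), by simp, rfl⟩ ⟨(b, j₂), by simp, rfl⟩ hi)
        (hg ⟨(a, j₁), by simp, rfl⟩ ⟨(b, j₂), by simp, rfl⟩ h12)
        (hg ⟨(b, j₂), by simp, rfl⟩ ⟨(a, j₃), by simp, rfl⟩ h23)
        (hg ⟨(a, j₃), by simp, rfl⟩ ⟨(b, j₄), by simp, rfl⟩ h34)
        (h (a, j₁) (by simp)) (h (b, j₂) (by simp)) (h (a, j₃) (by simp)) (h (b, j₄) (by simp))
    · have := hC _ _ (A.S.image (Prod.map (OrderDual.toDual (α := A.R)) (id : A.C → A.C))) ?_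
      · rw [card_image_toDual] at this
        exact this.trans (Nat.mul_le_mul_left _ (lines_image_toDual _))
      rintro ⟨f, g, hf, hg, h⟩
      have hlt := hf ⟨(b, j₂), by simp, rfl⟩ ⟨(a, j₁), by simp, rfl⟩ hi
      exact A.alt (OrderDual.ofDual (f a)) (OrderDual.ofDual (f b)) (g j₁) (g j₂) (g j₃) (g j₄)
        hlt
        (hg ⟨(a, j₁), by simp, rfl⟩ ⟨(b, j₂), by simp, rfl⟩ h12)
        (hg ⟨(b, j₂), by simp, rfl⟩ ⟨(a, j₃), by simp, rfl⟩ h23)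
        (hg ⟨(a, j₃), by simp, rfl⟩ ⟨(b, j₄), by simp, rfl⟩ h34)
        (mem_image_toDual (h (a, j₁) (by simp))) (mem_image_toDual (h (b, j₂) (by simp)))
        (mem_image_toDual (h (a, j₃) (by simp))) (mem_image_toDual (h (b, j₄) (by simp)))
  have h1 := A.mul_lines_le
  have hL : 0 < A.L.card := lt_of_lt_of_le (Nat.succ_pos _) A.le_card_L
  obtain ⟨c, hc⟩ := Finset.card_pos.1 hL
  have hpos : 0 < A.S.card := lt_of_lt_of_le (by rw [A.card_live c hc]; omega)
    (Finset.card_le_card (Finset.filter_subset (fun z => z.2 = c) A.S))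
  nlinarith

/-- A pattern that is not linear but all of whose proper subpatterns are. -/
def MinimalPattern (Q : Finset (γ × δ)) : Prop :=
  ¬ LinearPattern Q ∧ ∀ R ⊂ Q, LinearPattern R

theorem MinimalPattern.eq_of_subset {Q R : Finset (γ × δ)} (h : MinimalPattern Q) (hR : R ⊆ Q)
    (hn : ¬ LinearPattern R) : R = Q := by
  by_contra hne
  exact hn (h.2 R (hR.ssubset_of_ne hne))

theorem MinimalPattern.swap {Q : Finset (γ × δ)} (h : MinimalPattern Q) :
    MinimalPattern (Q.image Prod.swap) := by
  refine ⟨fun h' => h.1 (linearPattern_swap_iff.1 h'), fun R hR => ?_⟩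
  rw [← linearPattern_swap_iff]
  refine h.2 _ ?_
  have h1 : R.image Prod.swap ⊆ Q := by
    have := Finset.image_subset_image (f := Prod.swap) hR.1
    rwa [swap_swap_image] at this
  refine h1.ssubset_of_ne fun he => hR.2 ?_
  rw [← he, swap_swap_image]

end

/-! ### The extremal function and linear patterns -/

/-- The positions of the ones of `P`. -/
def onesSet (P : ZeroOneMatrix) : Finset (Fin P.rows × Fin P.cols) :=
  Finset.univ.filter fun p => P.entry p.1 p.2 = true

theorem mem_onesSet {P : ZeroOneMatrix} {i : Fin P.rows} {j : Fin P.cols} :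
    (i, j) ∈ onesSet P ↔ P.entry i j = true := by
  simp [onesSet]

theorem ones_le_ex {P : ZeroOneMatrix} {n : ℕ} {A : Matrix (Fin n) (Fin n) Bool}
    (h : Avoids ⟨n, n, A⟩ P) : ones ⟨n, n, A⟩ ≤ ex n P := by
  classical
  unfold ex
  exact Finset.le_sup (f := fun A => ones ⟨n, n, A⟩) (by simpa using h)

theorem linearPattern_of_isBigO {P : ZeroOneMatrix}
    (h : (fun n : ℕ => (ex n P : ℝ)) =O[atTop] fun n : ℕ => (n : ℝ)) :
    LinearPattern (onesSet P) := by
  obtain ⟨c, hc⟩ := h.bound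
  obtain ⟨N, hN⟩ := eventually_atTop.1 hc
  refine ⟨⌈c⌉₊ * (N + 1), fun S hS => ?_⟩
  rcases S.eq_empty_or_nonempty with rfl | hne
  · simp
  have hT : ¬ Embeds (squeeze S) (onesSet P) := fun h => hS ((embeds_squeeze hne).trans h)
  have hlines : 1 ≤ lines S := by
    have : 0 < (S.image Prod.fst).card := Finset.card_pos.2 (hne.image _)
    unfold lines
    omega
  -- This n is beyond the threshold N and large enough for the squeezed set; as `lines S` ≥ 1, it is
  -- at most (N + 1) · `lines S`.
  set n := N + lines S with hn
  have hlt : ∀ x ∈ squeeze S, x.1 < n ∧ x.2 < n := by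
    intro x hx
    obtain ⟨y, hy, rfl⟩ := Finset.mem_image.1 hx
    have h1 := position_lt (Finset.mem_image_of_mem Prod.fst hy)
    have h2 := position_lt (Finset.mem_image_of_mem Prod.snd hy)
    have h3 : lines S = (S.image Prod.fst).card + (S.image Prod.snd).card := rfl
    simp only [Prod.map_fst, Prod.map_snd]
    omega
  let A : Matrix (Fin n) (Fin n) Bool := fun x y => decide ((x.val, y.val) ∈ squeeze S)
  have hA : Avoids ⟨n, n, A⟩ P := by
    rintro ⟨r, c, h⟩
    refine hT ⟨fun i => (r i).val, fun j => (c j).val, ?_, ?_, ?_⟩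
    · exact StrictMono.strictMonoOn (fun i i' hi => r.strictMono hi) _
    · exact StrictMono.strictMonoOn (fun i i' hi => c.strictMono hi) _
    · rintro ⟨i, j⟩ hx
      simpa [A] using h i j (mem_onesSet.1 hx)
  have h1 : S.card ≤ ones ⟨n, n, A⟩ := by
    rw [← card_squeeze]
    refine Finset.card_le_card_of_surjOn (fun p : Fin n × Fin n => (p.1.val, p.2.val)) ?_
    rintro ⟨x, y⟩ hx
    have := hlt _ hx
    exact ⟨(⟨x, this.1⟩, ⟨y, this.2⟩), by simpa [A] using hx, rfl⟩
  have h2 := h1.trans (ones_le_ex hA)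
  have h3 := hN n (Nat.le_add_right _ _)
  simp only [Real.norm_natCast] at h3
  have h4 : (ex n P : ℝ) ≤ ((⌈c⌉₊ * n : ℕ) : ℝ) := by
    push_cast
    exact h3.trans (mul_le_mul_of_nonneg_right (Nat.le_ceil c) (Nat.cast_nonneg n))
  have h5 : ex n P ≤ ⌈c⌉₊ * n := by exact_mod_cast h4
  refine (h2.trans h5).trans ?_
  rw [mul_assoc]
  refine Nat.mul_le_mul_left _ ?_
  rw [hn]
  nlinarith

/-- Empty lines of a pattern still need room in a matrix. Equal residues modulo k + 1 force gaps of
at least k + 1 between the prescribed values, and margins of k remain at both ends, so the missing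
indices fit. -/
theorem exists_orderEmbedding_extending {k n s : ℕ} {U : Set (Fin k)} {f : Fin k → ℕ}
    (hf : StrictMonoOn f U) (hmod : ∀ u ∈ U, f u % (k + 1) = s) (hlow : ∀ u ∈ U, k ≤ f u)
    (hhigh : ∀ u ∈ U, f u + k < n) (hk : k ≤ n) :
    ∃ F : Fin k ↪o Fin n, ∀ u ∈ U, (F u : ℕ) = f u := by
  classical
  have gap : ∀ u ∈ U, ∀ v ∈ U, u < v → f u + (k + 1) ≤ f v := by
    intro u hu v hv huv
    have hlt := hf hu hv huv
    have hdvd := (Nat.modEq_iff_dvd' hlt.le).1 (show f u ≡ f v [MOD (k + 1)] from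
      (hmod u hu).trans (hmod v hv).symm)
    have := Nat.le_of_dvd (by omega) hdvd
    omega
  -- Count upwards by ones from the prescribed values to the left, or from 0 if there are none; the
  -- gaps ensure that the next prescribed value is not overshot.
  let G : Fin k → ℕ := fun x =>
    ((Finset.univ.filter fun u => u ∈ U ∧ u ≤ x).sup fun u => f u + (x.val - u.val)) ⊔ x.val
  have hG : StrictMono G := by
    intro x y hxy
    have hxy' : x.val < y.val := hxy
    refine max_lt ?_ (lt_of_lt_of_le hxy' (le_max_right _ _))
    have hpos : 0 < G y := lt_of_lt_of_le (by omega) (le_max_right _ y.val)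
    refine (Finset.sup_lt_iff hpos).2 fun u hu => ?_
    obtain ⟨-, huU, hux⟩ := Finset.mem_filter.1 hu
    have hux' : u.val ≤ x.val := hux
    have h1 : f u + (y.val - u.val) ≤ G y := le_trans
      (Finset.le_sup (f := fun u : Fin k => f u + (y.val - u.val))
        (Finset.mem_filter.2 ⟨Finset.mem_univ _, huU, hux.trans hxy.le⟩)) (le_max_left _ _)
    omega
  have hGn : ∀ x, G x < n := by
    intro x
    have hx := x.2
    refine max_lt ?_ (by omega)
    refine (Finset.sup_lt_iff (by simp only [bot_eq_zero']; omega)).2 fun u hu => ?_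
    obtain ⟨-, huU, hux⟩ := Finset.mem_filter.1 hu
    have := hhigh u huU
    omega
  refine ⟨OrderEmbedding.ofStrictMono (fun x => ⟨G x, hGn x⟩) (fun x y h => hG h), ?_⟩
  intro u hu
  change G u = f u
  refine le_antisymm (max_le (Finset.sup_le fun v hv => ?_) ?_) ?_
  · obtain ⟨-, hvU, hvu⟩ := Finset.mem_filter.1 hv
    rcases hvu.lt_or_eq with h | rfl
    · have := gap v hvU u hu h
      have := u.2
      omega
    · simp
  · have := hlow u hu
    omega
  · refine le_trans ?_ (le_max_left _ _)
    refine le_trans ?_ (Finset.le_sup (f := fun v : Fin k => f v + (u.val - v.val))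
        (Finset.mem_filter.2 ⟨Finset.mem_univ u, hu, le_rfl⟩))
    simp

theorem exists_ex_le_of_linearPattern {P : ZeroOneMatrix} (h : LinearPattern (onesSet P)) :
    ∃ C N : ℕ, ∀ n, N ≤ n → ex n P ≤ C * n := by
  classical
  obtain ⟨C, hC⟩ := h
  set k := P.rows with hk
  set c := P.cols with hc
  refine ⟨(k + 1) * (c + 1) * (C * 2) + 2 * k + 2 * c, k + c, fun n hn => ?_⟩
  unfold ex
  refine Finset.sup_le fun A hA => ?_
  replace hA : Avoids ⟨n, n, A⟩ P := by simpa using hA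
  let T : Finset (ℕ × ℕ) :=
    (onesSet ⟨n, n, A⟩).image fun p : Fin n × Fin n => (p.1.val, p.2.val)
  have hT : ∀ x ∈ T, x.1 < n ∧ x.2 < n := by
    intro x hx
    obtain ⟨y, -, rfl⟩ := Finset.mem_image.1 hx
    exact ⟨y.1.2, y.2.2⟩
  have hones : ones ⟨n, n, A⟩ = T.card := by
    refine (Finset.card_image_of_injective _ ?_).symm
    rintro ⟨a, b⟩ ⟨a', b'⟩ h
    simp only [Prod.mk.injEq] at h
    exact Prod.ext (Fin.ext h.1) (Fin.ext h.2)
  have hmem : ∀ (x y : Fin n), (x.val, y.val) ∈ T → A x y = true := by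
    intro x y h
    obtain ⟨⟨a, b⟩, hp, h⟩ := Finset.mem_image.1 h
    simp only [Prod.mk.injEq] at h
    obtain rfl := Fin.ext h.1
    obtain rfl := Fin.ext h.2
    exact mem_onesSet.1 hp
  let D : ℕ × ℕ → Finset (ℕ × ℕ) := fun st => T.filter fun x =>
    (x.1 % (k + 1), x.2 % (c + 1)) = st ∧ (k ≤ x.1 ∧ x.1 + k < n) ∧ (c ≤ x.2 ∧ x.2 + c < n)
  have hD : ∀ st, (D st).card ≤ C * 2 * n := by
    intro st
    have hno : ¬ Embeds (D st) (onesSet P) := by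
      rintro ⟨f, g, hf, hg, h⟩
      have hx : ∀ x ∈ onesSet P, (f x.1 % (k + 1) = st.1 ∧ k ≤ f x.1 ∧ f x.1 + k < n) ∧
          (g x.2 % (c + 1) = st.2 ∧ c ≤ g x.2 ∧ g x.2 + c < n) := by
        intro x hx
        obtain ⟨-, h1, h2, h3⟩ := Finset.mem_filter.1 (h x hx)
        exact ⟨⟨congrArg Prod.fst h1, h2⟩, congrArg Prod.snd h1, h3⟩
      obtain ⟨F, hF⟩ := exists_orderEmbedding_extending (n := n) (s := st.1) hf
        (by rintro _ ⟨x, hx', rfl⟩; exact (hx x hx').1.1)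
        (by rintro _ ⟨x, hx', rfl⟩; exact (hx x hx').1.2.1)
        (by rintro _ ⟨x, hx', rfl⟩; exact (hx x hx').1.2.2) (by omega)
      obtain ⟨G, hG⟩ := exists_orderEmbedding_extending (n := n) (s := st.2) hg
        (by rintro _ ⟨x, hx', rfl⟩; exact (hx x hx').2.1)
        (by rintro _ ⟨x, hx', rfl⟩; exact (hx x hx').2.2.1)
        (by rintro _ ⟨x, hx', rfl⟩; exact (hx x hx').2.2.2) (by omega)
      refine hA ⟨F, G, fun i j hij => ?_⟩
      have hij' : (i, j) ∈ onesSet P := mem_onesSet.2 hij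
      apply hmem
      rw [hF i ⟨_, hij', rfl⟩, hG j ⟨_, hij', rfl⟩]
      exact (Finset.mem_filter.1 (h _ hij')).1
    refine (hC _ hno).trans ?_
    rw [mul_assoc]
    refine Nat.mul_le_mul_left _ ?_
    have h1 : ((D st).image Prod.fst) ⊆ Finset.range n := by
      intro x hx
      obtain ⟨p, hp, rfl⟩ := Finset.mem_image.1 hx
      exact Finset.mem_range.2 (hT p (Finset.mem_filter.1 hp).1).1
    have h2 : ((D st).image Prod.snd) ⊆ Finset.range n := by
      intro x hx
      obtain ⟨p, hp, rfl⟩ := Finset.mem_image.1 hx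
      exact Finset.mem_range.2 (hT p (Finset.mem_filter.1 hp).1).2
    replace h1 := Finset.card_le_card h1
    replace h2 := Finset.card_le_card h2
    rw [Finset.card_range] at h1 h2
    unfold lines
    omega
  -- Away from the margins the ones split into (k + 1)(c + 1) residue classes, each avoiding the
  -- pattern; the margins, 2k rows and 2c columns, hold at most (2k + 2c)n ones.
  have hcover : T ⊆ ((Finset.range (k + 1) ×ˢ Finset.range (c + 1)).biUnion D) ∪
      (((Finset.range k ∪ Finset.Ico (n - k) n) ×ˢ Finset.range n) ∪
        (Finset.range n ×ˢ (Finset.range c ∪ Finset.Ico (n - c) n))) := by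
    rintro ⟨x, y⟩ hx
    have hlt := hT _ hx
    simp only at hlt
    by_cases h1 : k ≤ x ∧ x + k < n
    · by_cases h2 : c ≤ y ∧ y + c < n
      · refine Finset.mem_union_left _ (Finset.mem_biUnion.2
          ⟨(x % (k + 1), y % (c + 1)), ?_, Finset.mem_filter.2 ⟨hx, rfl, h1, h2⟩⟩)
        exact Finset.mem_product.2 ⟨Finset.mem_range.2 (Nat.mod_lt _ (Nat.succ_pos _)),
          Finset.mem_range.2 (Nat.mod_lt _ (Nat.succ_pos _))⟩
      · refine Finset.mem_union_right _ (Finset.mem_union_right _ ?_)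
        simp only [Finset.mem_product, Finset.mem_union, Finset.mem_range, Finset.mem_Ico]
        omega
    · refine Finset.mem_union_right _ (Finset.mem_union_left _ ?_)
      simp only [Finset.mem_product, Finset.mem_union, Finset.mem_range, Finset.mem_Ico]
      omega
  have hmargin : ∀ d, (Finset.range d ∪ Finset.Ico (n - d) n).card ≤ 2 * d := by
    intro d
    refine (Finset.card_union_le _ _).trans ?_
    rw [Finset.card_range, Nat.card_Ico]
    omega
  rw [hones]
  refine (Finset.card_le_card hcover).trans ((Finset.card_union_le _ _).trans ?_)
  have h1 : ((Finset.range (k + 1) ×ˢ Finset.range (c + 1)).biUnion D).card ≤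
      (k + 1) * (c + 1) * (C * 2 * n) := by
    have := Finset.card_biUnion_le_card_mul (Finset.range (k + 1) ×ˢ Finset.range (c + 1)) D
      (C * 2 * n) fun st _ => hD st
    rwa [Finset.card_product, Finset.card_range, Finset.card_range] at this
  have h2 := (Finset.card_union_le ((Finset.range k ∪ Finset.Ico (n - k) n) ×ˢ Finset.range n)
    (Finset.range n ×ˢ (Finset.range c ∪ Finset.Ico (n - c) n)))
  rw [Finset.card_product, Finset.card_product, Finset.card_range] at h2
  have h3 := Nat.mul_le_mul_right n (hmargin k)
  have h4 := Nat.mul_le_mul_left n (hmargin c)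
  nlinarith

theorem MinimallyNonlinear.not_linearPattern {P : ZeroOneMatrix} (h : P.MinimallyNonlinear) :
    ¬ LinearPattern (onesSet P) := by
  intro hl
  obtain ⟨C, N, hC⟩ := exists_ex_le_of_linearPattern hl
  -- The little-o constant is chosen so that 2(C + 1)n ≤ ex(n, P) ≤ Cn eventually, which is absurd
  -- for n > 0.
  have h1 := h.1.bound (c := 1 / (2 * (C + 1))) (by positivity)
  obtain ⟨N', hN'⟩ := eventually_atTop.1 h1
  have h2 := hN' (N + N' + 1) (by omega)
  have h3 := hC (N + N' + 1) (by omega)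
  simp only [Real.norm_natCast] at h2
  have h4 : (ex (N + N' + 1) P : ℝ) ≤ C * ((N + N' + 1 : ℕ) : ℝ) := by exact_mod_cast h3
  have h5 : (0 : ℝ) < ((N + N' + 1 : ℕ) : ℝ) := by exact_mod_cast Nat.succ_pos _
  set x := ((N + N' + 1 : ℕ) : ℝ)
  have h6 : (0 : ℝ) ≤ C := Nat.cast_nonneg C
  have h7 : x * (2 * (C + 1)) ≤ (ex (N + N' + 1) P : ℝ) := by
    have := mul_le_mul_of_nonneg_right h2 (show (0 : ℝ) ≤ 2 * (C + 1) by positivity)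
    have e : 1 / (2 * ((C : ℝ) + 1)) * (ex (N + N' + 1) P : ℝ) * (2 * (C + 1)) =
        (ex (N + N' + 1) P : ℝ) := by field_simp
    rwa [e] at this
  nlinarith

theorem MinimallyNonlinear.minimalPattern {P : ZeroOneMatrix} (h : P.MinimallyNonlinear) :
    MinimalPattern (onesSet P) := by
  classical
  refine ⟨h.not_linearPattern, fun R hR => ?_⟩
  let P' : ZeroOneMatrix := ⟨P.rows, P.cols, fun i j => decide ((i, j) ∈ R)⟩
  have hP' : onesSet P' = R := by
    ext ⟨i, j⟩
    rw [mem_onesSet]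
    exact decide_eq_true_iff
  have hc : P.Contains P' := by
    refine ⟨RelEmbedding.refl _, RelEmbedding.refl _, fun i j hij => ?_⟩
    exact mem_onesSet.1 (hR.1 (of_decide_eq_true hij))
  have hne : P' ≠ P := by
    intro he
    have hR' : R = onesSet P := by
      ext ⟨i, j⟩
      have : P.entry i j = decide ((i, j) ∈ R) := by
        obtain ⟨r, c, e⟩ := P
        have : e = fun i j => decide ((i, j) ∈ R) := by
          have := (ZeroOneMatrix.mk.injEq _ _ _ _ _ _).mp he
          exact (eq_of_heq this.2.2).symm
        exact congrFun (congrFun this i) j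
      rw [mem_onesSet, this, decide_eq_true_iff]
    exact hR.ne hR'
  rw [← hP']
  exact linearPattern_of_isBigO (h.2 P' hc hne)

/-- Deleting an empty column gives a strictly smaller contained matrix, linear by minimality, with
the same ones up to monotone relabelling. -/
theorem MinimallyNonlinear.exists_one_in_col {P : ZeroOneMatrix} (h : P.MinimallyNonlinear)
    (j : Fin P.cols) : ∃ i, (i, j) ∈ onesSet P := by
  classical
  by_contra! hno
  obtain ⟨r, c, e⟩ := P
  simp only at j hno
  obtain _ | c := c
  · exact j.elim0
  let P' : ZeroOneMatrix := ⟨r, c, fun i j' => e i (j.succAbove j')⟩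
  have hc : Contains ⟨r, c + 1, e⟩ P' :=
    ⟨RelEmbedding.refl _, Fin.succAboveOrderEmb j, fun i j hij => hij⟩
  have hne : P' ≠ ⟨r, c + 1, e⟩ := by
    intro he
    have := congrArg ZeroOneMatrix.cols he
    simp [P'] at this
  refine h.not_linearPattern ?_
  have hl := (linearPattern_of_isBigO (h.2 P' hc hne)).image (φ := id) (ψ := j.succAbove)
    strictMono_id (Fin.strictMono_succAbove j)
  refine hl.mono ?_
  rintro ⟨i, j'⟩ hx
  rcases Fin.eq_self_or_eq_succAbove j j' with rfl | ⟨j', rfl⟩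
  · exact absurd hx (hno i)
  · exact Finset.mem_image.2 ⟨(i, j'), (mem_onesSet (P := P')).2 (mem_onesSet.1 hx :), rfl⟩

theorem MinimallyNonlinear.exists_one_in_row {P : ZeroOneMatrix} (h : P.MinimallyNonlinear)
    (i : Fin P.rows) : ∃ j, (i, j) ∈ onesSet P := by
  classical
  by_contra! hno
  obtain ⟨r, c, e⟩ := P
  simp only at i hno
  obtain _ | r := r
  · exact i.elim0
  let P' : ZeroOneMatrix := ⟨r, c, fun i' j => e (i.succAbove i') j⟩
  have hc : Contains ⟨r + 1, c, e⟩ P' :=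
    ⟨Fin.succAboveOrderEmb i, RelEmbedding.refl _, fun i j hij => hij⟩
  have hne : P' ≠ ⟨r + 1, c, e⟩ := by
    intro he
    have := congrArg ZeroOneMatrix.rows he
    simp [P'] at this
  refine h.not_linearPattern ?_
  have hl := (linearPattern_of_isBigO (h.2 P' hc hne)).image (φ := i.succAbove) (ψ := id)
    (Fin.strictMono_succAbove i) strictMono_id
  refine hl.mono ?_
  rintro ⟨i', j⟩ hx
  rcases Fin.eq_self_or_eq_succAbove i i' with rfl | ⟨i', rfl⟩
  · exact absurd hx (hno j)
  · exact Finset.mem_image.2 ⟨(i', j), (mem_onesSet (P := P')).2 (mem_onesSet.1 hx :), rfl⟩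

/-! ### The number of columns -/

/-- The positions at which a sequence of length `c` changes its value. -/
def changes {α : Type} [DecidableEq α] (c : ℕ) (ρ : ℕ → α) : Finset ℕ :=
  (Finset.range (c - 1)).filter fun t => ρ t ≠ ρ (t + 1)

/-- At a change t, either the value at t + 1 occurs for the first time or the value at t occurs for
the last time; otherwise an alternation appears. The first kind never produces the initial value and
the second never leaves the final one, so each occurs at most k - 1 times. -/
theorem card_changes_le {k c : ℕ} {ρ : ℕ → Fin k}
    (h : ∀ s t u v, s < t → t < u → u < v → v < c → ρ s = ρ u → ρ t = ρ v → ρ s = ρ t) :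
    (changes c ρ).card ≤ 2 * (k - 1) := by
  classical
  let A := (changes c ρ).filter fun t => ∀ s ≤ t, ρ s ≠ ρ (t + 1)
  let B := (changes c ρ).filter fun t => ∀ s, t < s → s < c → ρ s ≠ ρ t
  have hAB : changes c ρ ⊆ A ∪ B := by
    intro t ht
    by_contra hn
    simp only [A, B, Finset.mem_union, Finset.mem_filter, ht, true_and, not_or] at hn
    push Not at hn
    obtain ⟨⟨s, hs, hse⟩, v, hv, hvc, hve⟩ := hn
    obtain ⟨-, hne⟩ := Finset.mem_filter.1 ht
    have h1 : s ≠ t := by rintro rfl; exact hne hse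
    have h2 : v ≠ t + 1 := by rintro rfl; exact hne hve.symm
    exact hne ((h s t (t + 1) v (by omega) (by omega) (by omega) hvc hse hve.symm).symm.trans hse)
  have hA : A.card ≤ k - 1 := by
    have : (Finset.univ.erase (ρ 0)).card = k - 1 := by
      rw [Finset.card_erase_of_mem (Finset.mem_univ _), Finset.card_univ, Fintype.card_fin]
    rw [← this]
    refine Finset.card_le_card_of_injOn (fun t => ρ (t + 1)) ?_ ?_
    · intro t ht
      have ht := (Finset.mem_filter.1 (Finset.mem_coe.1 ht)).2
      simpa using (ht 0 (Nat.zero_le _)).symm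
    · intro t ht t' ht' he
      have ht := (Finset.mem_filter.1 (Finset.mem_coe.1 ht)).2
      have ht' := (Finset.mem_filter.1 (Finset.mem_coe.1 ht')).2
      simp only at he
      rcases lt_trichotomy t t' with hlt | heq | hlt
      · exact absurd he (ht' (t + 1) hlt)
      · exact heq
      · exact absurd he.symm (ht (t' + 1) hlt)
  have hB : B.card ≤ k - 1 := by
    have : (Finset.univ.erase (ρ (c - 1))).card = k - 1 := by
      rw [Finset.card_erase_of_mem (Finset.mem_univ _), Finset.card_univ, Fintype.card_fin]
    rw [← this]
    refine Finset.card_le_card_of_injOn ρ ?_ ?_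
    · intro t ht
      obtain ⟨h1, ht⟩ := Finset.mem_filter.1 (Finset.mem_coe.1 ht)
      have h1 := Finset.mem_range.1 (Finset.mem_filter.1 h1).1
      simpa using (ht (c - 1) h1 (by omega)).symm
    · intro t ht t' ht' he
      obtain ⟨h1, ht⟩ := Finset.mem_filter.1 (Finset.mem_coe.1 ht)
      obtain ⟨h1', ht'⟩ := Finset.mem_filter.1 (Finset.mem_coe.1 ht')
      have h1 := Finset.mem_range.1 (Finset.mem_filter.1 h1).1
      have h1' := Finset.mem_range.1 (Finset.mem_filter.1 h1').1
      rcases lt_trichotomy t t' with hlt | heq | hlt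
      · exact absurd he.symm (ht t' hlt (by omega))
      · exact heq
      · exact absurd he (ht' t hlt (by omega))
  have := (Finset.card_le_card hAB).trans (Finset.card_union_le _ _)
  omega

/-- By hypothesis the first and last runs have length 1 and the others at most 2. Hence every
non-change t is followed by a change at t + 1, and the change at 0 is never used. -/
theorem length_le_two_mul_card_changes {k c : ℕ} {ρ : ℕ → Fin k} (hc : 2 ≤ c)
    (h : ∀ j < c, ¬ ((j + 1 < c → ρ (j + 1) = ρ j) ∧ (0 < j → ρ (j - 1) = ρ j))) :
    c ≤ 2 * (changes c ρ).card := by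
  classical
  have hsplit := Finset.card_filter_add_card_filter_not (s := Finset.range (c - 1))
    (fun t => ρ t ≠ ρ (t + 1))
  rw [Finset.card_range] at hsplit
  have h0 : 0 ∈ changes c ρ := by
    refine Finset.mem_filter.2 ⟨Finset.mem_range.2 (by omega), fun he => ?_⟩
    exact h 0 (by omega) ⟨fun _ => he.symm, fun h => absurd h (lt_irrefl _)⟩
  have hle : ((Finset.range (c - 1)).filter fun t => ¬ ρ t ≠ ρ (t + 1)).card ≤
      ((changes c ρ).erase 0).card := by
    refine Finset.card_le_card_of_injOn (fun t => t + 1) ?_ fun a _ b _ hab => by simpa using hab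
    intro t ht
    obtain ⟨h1, h2⟩ := Finset.mem_filter.1 (Finset.mem_coe.1 ht)
    have h1 := Finset.mem_range.1 h1
    have h2 : ρ t = ρ (t + 1) := not_not.1 h2
    have h3 : t + 1 < c - 1 := by
      by_contra h3
      exact h (t + 1) (by omega) ⟨fun h => absurd h (by omega), fun _ => h2⟩
    refine Finset.mem_coe.2 (Finset.mem_erase.2 ⟨by simp, Finset.mem_filter.2
      ⟨Finset.mem_range.2 h3, fun he => ?_⟩⟩)
    exact h (t + 1) (by omega) ⟨fun _ => he.symm, fun _ => h2⟩
  rw [Finset.card_erase_of_mem h0] at hle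
  have hpos := Finset.card_pos.2 ⟨0, h0⟩
  have e : (changes c ρ).card =
      ((Finset.range (c - 1)).filter fun t => ρ t ≠ ρ (t + 1)).card := rfl
  omega

theorem card_changes_lt_update {k c j : ℕ} {ρ : ℕ → Fin k} {b : Fin k} (hc : 2 ≤ c) (hj : j < c)
    (hb : b ≠ ρ j) (h1 : j + 1 < c → ρ (j + 1) = ρ j) (h2 : 0 < j → ρ (j - 1) = ρ j) :
    (changes c ρ).card < (changes c (Function.update ρ j b)).card := by
  classical
  refine Finset.card_lt_card (Finset.ssubset_iff_of_subset ?_ |>.2 ?_)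
  · intro t ht
    obtain ⟨ht, hne⟩ := Finset.mem_filter.1 ht
    have htc := Finset.mem_range.1 ht
    have e1 : t ≠ j := by rintro rfl; exact hne (h1 (by omega)).symm
    have e2 : t + 1 ≠ j := by rintro rfl; exact hne (h2 (by omega))
    refine Finset.mem_filter.2 ⟨ht, ?_⟩
    rwa [Function.update_of_ne e1, Function.update_of_ne e2]
  · by_cases hjc : j + 1 < c
    · refine ⟨j, Finset.mem_filter.2 ⟨Finset.mem_range.2 (by omega), ?_⟩, fun h => ?_⟩
      · rw [Function.update_self, Function.update_of_ne (by omega), h1 hjc]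
        exact hb
      · exact (Finset.mem_filter.1 h).2 (h1 hjc).symm
    · have hj0 : 0 < j := by omega
      refine ⟨j - 1, Finset.mem_filter.2 ⟨Finset.mem_range.2 (by omega), ?_⟩, fun h => ?_⟩
      · rw [Nat.sub_add_cancel hj0, Function.update_self, Function.update_of_ne (by omega), h2 hj0]
        exact hb.symm
      · have := (Finset.mem_filter.1 h).2
        rw [Nat.sub_add_cancel hj0] at this
        exact this (h2 hj0)

/-- If (i, j) were alone in its column, erasing it would leave a linear pattern, and an insertion
lemma would make Q linear. -/
theorem MinimalPattern.exists_other_one {k c : ℕ} {Q : Finset (Fin k × Fin c)}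
    (hQ : MinimalPattern Q) (hc : 2 ≤ c) {i : Fin k} {j : ℕ} (hj : j < c) (hi : (i, ⟨j, hj⟩) ∈ Q)
    (h1 : ∀ h : j + 1 < c, (i, ⟨j + 1, h⟩) ∈ Q) (h2 : 0 < j → (i, ⟨j - 1, by omega⟩) ∈ Q) :
    ∃ b, b ≠ i ∧ (b, ⟨j, hj⟩) ∈ Q := by
  by_contra! hno
  set R := Q.erase (i, ⟨j, hj⟩) with hR
  have hins : insert (i, ⟨j, hj⟩) R = Q := Finset.insert_erase hi
  have hlin : LinearPattern R := hQ.2 R (Finset.erase_ssubset hi)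
  have hcol : ∀ x ∈ R, x.2.val ≠ j := by
    rintro ⟨a, b⟩ hx hb
    obtain ⟨hne, hx⟩ := Finset.mem_erase.1 hx
    have hb' : b = ⟨j, hj⟩ := Fin.ext hb
    subst hb'
    by_cases ha : a = i
    · subst ha; exact hne rfl
    · exact hno a ha hx
  have hmem : ∀ (j' : ℕ) (h : j' < c), j' ≠ j → (i, (⟨j', h⟩ : Fin c)) ∈ Q →
      (i, (⟨j', h⟩ : Fin c)) ∈ R := by
    intro j' h hne hm
    refine Finset.mem_erase.2 ⟨fun he => hne ?_, hm⟩
    simpa using congrArg (fun p => p.2.val) he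
  apply hQ.1
  rw [← hins]
  by_cases hjc : j + 1 < c
  · have m1 := hmem (j + 1) hjc (by omega) (h1 hjc)
    by_cases hj0 : 0 < j
    · have m2 := hmem (j - 1) (by omega) (by omega) (h2 hj0)
      refine hlin.insert_between m2 m1 (Fin.mk_lt_mk.2 (by omega)) (Fin.mk_lt_mk.2 (by omega)) ?_
      intro x hx
      have := hcol x hx
      simp only [Fin.le_def]
      omega
    · refine hlin.insert_first m1 (Fin.mk_lt_mk.2 (by omega)) ?_
      intro x hx
      have := hcol x hx
      simp only [Fin.le_def]
      omega
  · have m2 := hmem (j - 1) (by omega) (by omega) (h2 (by omega))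
    refine hlin.insert_last m2 (Fin.mk_lt_mk.2 (by omega)) ?_
    intro x hx
    have := hcol x hx
    have := x.2.2
    simp only [Fin.le_def]
    omega

theorem MinimalPattern.cols_le {k c : ℕ} {Q : Finset (Fin k × Fin c)} (hQ : MinimalPattern Q)
    (hcol : ∀ j, ∃ i, (i, j) ∈ Q) : c ≤ 1 ∨ c ≤ 4 * k - 4 := by
  classical
  by_cases hc : c ≤ 1
  · exact Or.inl hc
  right
  replace hc : 2 ≤ c := by omega
  by_cases halt : ∃ (a b : Fin k) (j₁ j₂ j₃ j₄ : Fin c), a ≠ b ∧ j₁ < j₂ ∧ j₂ < j₃ ∧ j₃ < j₄ ∧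
      (a, j₁) ∈ Q ∧ (b, j₂) ∈ Q ∧ (a, j₃) ∈ Q ∧ (b, j₄) ∈ Q
  · obtain ⟨a, b, j₁, j₂, j₃, j₄, hab, h12, h23, h34, m1, m2, m3, m4⟩ := halt
    have hsub : ({(a, j₁), (b, j₂), (a, j₃), (b, j₄)} : Finset (Fin k × Fin c)) ⊆ Q := by
      intro x hx
      simp only [Finset.mem_insert, Finset.mem_singleton] at hx
      rcases hx with rfl | rfl | rfl | rfl <;> assumption
    have he := hQ.eq_of_subset hsub (not_linearPattern_alternation hab h12 h23 h34)
    have huniv : (Finset.univ : Finset (Fin c)) ⊆ {j₁, j₂, j₃, j₄} := by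
      intro j _
      obtain ⟨i, hi⟩ := hcol j
      rw [← he] at hi
      simp only [Finset.mem_insert, Finset.mem_singleton, Prod.mk.injEq] at hi ⊢
      tauto
    have h4 := (Finset.card_le_card huniv).trans Finset.card_le_four
    rw [Finset.card_univ, Fintype.card_fin] at h4
    have hk : 2 ≤ k := by
      have := a.2
      have := b.2
      have : a.val ≠ b.val := fun h => hab (Fin.ext h)
      omega
    omega
  · have hgood : ∃ ρ : ℕ → Fin k, ∀ j (h : j < c), (ρ j, ⟨j, h⟩) ∈ Q := by
      choose ρ hρ using hcol
      refine ⟨fun j => if h : j < c then ρ ⟨j, h⟩ else ρ ⟨0, by omega⟩, fun j h => ?_⟩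
      simp only [h, dif_pos]
      exact hρ _
    -- Choose a row for each column with the maximal number of changes. At an entry that agrees with
    -- all its neighbours, another one of that column could be chosen instead, creating a change and
    -- destroying none.
    let s : Set ℕ := {m | ∃ ρ : ℕ → Fin k, (∀ j (h : j < c), (ρ j, ⟨j, h⟩) ∈ Q) ∧
      (changes c ρ).card = m}
    have hbdd : BddAbove s := by
      refine ⟨c, ?_⟩
      rintro m ⟨ρ, -, rfl⟩
      refine (Finset.card_filter_le _ _).trans ?_
      rw [Finset.card_range]
      omega
    have hne : s.Nonempty := by
      obtain ⟨ρ, hρ⟩ := hgood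
      exact ⟨_, ρ, hρ, rfl⟩
    obtain ⟨ρ, hρ, hmax⟩ := Nat.sSup_mem hne hbdd
    have hkey : ∀ j < c, ¬ ((j + 1 < c → ρ (j + 1) = ρ j) ∧ (0 < j → ρ (j - 1) = ρ j)) := by
      rintro j hj ⟨h1, h2⟩
      obtain ⟨b, hb, hbQ⟩ := hQ.exists_other_one hc hj (hρ j hj)
        (fun h => by rw [← h1 h]; exact hρ _ h)
        (fun h => by
          have := hρ (j - 1) (by omega)
          rwa [h2 h] at this)
      have hlt := card_changes_lt_update hc hj hb h1 h2
      rw [hmax] at hlt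
      refine absurd (le_csSup hbdd ⟨Function.update ρ j b, ?_, rfl⟩) hlt.not_ge
      intro j' h'
      by_cases he : j' = j
      · subst he
        rwa [Function.update_self]
      · rw [Function.update_of_ne he]
        exact hρ j' h'
    have h1 := length_le_two_mul_card_changes hc hkey
    have h2 : (changes c ρ).card ≤ 2 * (k - 1) := by
      refine card_changes_le ?_
      intro s t u v hst htu huv hv hsu htv
      by_contra hne
      refine halt ⟨ρ s, ρ t, ⟨s, by omega⟩, ⟨t, by omega⟩, ⟨u, by omega⟩, ⟨v, hv⟩, hne,
        hst, htu, huv, hρ s _, hρ t _, ?_, ?_⟩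
      · rw [hsu]; exact hρ u _
      · rw [htv]; exact hρ v _
    omega

theorem MinimalPattern.rows_le {k c : ℕ} {Q : Finset (Fin k × Fin c)} (hQ : MinimalPattern Q)
    (hrow : ∀ i, ∃ j, (i, j) ∈ Q) : k ≤ 1 ∨ k ≤ 4 * c - 4 := by
  refine hQ.swap.cols_le fun i => ?_
  obtain ⟨j, h⟩ := hrow i
  exact ⟨j, Finset.mem_image.2 ⟨_, h, rfl⟩⟩

/-! ### Encoding by the last ones of the rows and one further one per column -/

/-- Otherwise Q would be a fork, which occupies only two rows, while all k > 2 rows are occupied. -/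
theorem MinimalPattern.nonlast_unique {k c : ℕ} {Q : Finset (Fin k × Fin c)}
    (hQ : MinimalPattern Q) (hk : 2 < k) (hrow : ∀ i, ∃ j, (i, j) ∈ Q) {i i' : Fin k}
    {b a d : Fin c} (hib : (i, b) ∈ Q) (hia : (i, a) ∈ Q) (hib' : (i', b) ∈ Q)
    (hid : (i', d) ∈ Q) (ha : b < a) (hd : b < d) : i = i' := by
  by_contra hne
  have hsub : ({(i, b), (i, a), (i', b), (i', d)} : Finset (Fin k × Fin c)) ⊆ Q := by
    intro x hx
    simp only [Finset.mem_insert, Finset.mem_singleton] at hx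
    rcases hx with rfl | rfl | rfl | rfl <;> assumption
  have he := hQ.eq_of_subset hsub (not_linearPattern_fork hne ha hd)
  have huniv : (Finset.univ : Finset (Fin k)) ⊆ {i, i'} := by
    intro r _
    obtain ⟨j, hj⟩ := hrow r
    rw [← he] at hj
    simp only [Finset.mem_insert, Finset.mem_singleton, Prod.mk.injEq] at hj ⊢
    tauto
  have h2 := (Finset.card_le_card huniv).trans Finset.card_le_two
  rw [Finset.card_univ, Fintype.card_fin] at h2
  omega

/-- The matrix with a one in row `r` and column `f r` for all `r`, and in row `g b` and column `b`
for every column `b` but the last. -/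
def decode (k m : ℕ) (p : (Fin k → Fin (m + 1)) × (Fin m → Fin k)) : ZeroOneMatrix :=
  ⟨k, m + 1, fun r c => decide (p.1 r = c ∨ ∃ b : Fin m, b.castSucc = c ∧ p.2 b = r)⟩

/-- The codes of matrices whose last column is not empty. -/
def codes (k m : ℕ) : Finset ((Fin k → Fin (m + 1)) × (Fin m → Fin k)) :=
  (Finset.univ.filter fun f => ∃ r, f r = Fin.last m) ×ˢ Finset.univ

theorem card_codes (k m : ℕ) :
    ((codes k m).card : ℤ) = (((m + 1 : ℕ) : ℤ) ^ k - (((m + 1 : ℕ) : ℤ) - 1) ^ k) * (k : ℤ) ^ m := by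
  have h1 := Finset.card_filter_add_card_filter_not (s := (Finset.univ : Finset (Fin k → Fin (m + 1))))
    (fun f => ∃ r, f r = Fin.last m)
  have h2 : (Finset.univ.filter fun f : Fin k → Fin (m + 1) => ¬ ∃ r, f r = Fin.last m) =
      Fintype.piFinset fun _ => Finset.univ.erase (Fin.last m) := by
    ext f
    simp
  rw [h2, Fintype.card_piFinset_const, Finset.card_erase_of_mem (Finset.mem_univ _),
    Finset.card_univ, Finset.card_univ, Fintype.card_fin, Fintype.card_fun, Fintype.card_fin,
    Fintype.card_fin, Nat.add_sub_cancel] at h1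
  rw [codes, Finset.card_product, Finset.card_univ, Fintype.card_fun, Fintype.card_fin,
    Fintype.card_fin]
  have h3 : (((Finset.univ.filter fun f : Fin k → Fin (m + 1) => ∃ r, f r = Fin.last m).card : ℕ) :
      ℤ) = ((m + 1 : ℕ) : ℤ) ^ k - (m : ℤ) ^ k := by
    rw [eq_sub_iff_add_eq]
    exact_mod_cast h1
  rw [Nat.cast_mul, h3]
  push_cast
  ring

theorem MinimallyNonlinear.mem_image_decode {k m : ℕ} (hk : 2 < k)
    {e : Matrix (Fin k) (Fin (m + 1)) Bool} (h : MinimallyNonlinear ⟨k, m + 1, e⟩) :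
    ∃ p ∈ codes k m, decode k m p = ⟨k, m + 1, e⟩ := by
  classical
  have hQ := h.minimalPattern
  have hrow := h.exists_one_in_row
  have hcol := h.exists_one_in_col
  set Q : Finset (Fin k × Fin (m + 1)) := onesSet ⟨k, m + 1, e⟩ with hQdef
  have hlast : ∀ r : Fin k, ∃ c, (r, c) ∈ Q ∧ ∀ c', (r, c') ∈ Q → c' ≤ c := by
    intro r
    obtain ⟨c, hc⟩ := hrow r
    obtain ⟨c, hc, hmax⟩ := Finset.exists_max_image (Finset.univ.filter fun c => (r, c) ∈ Q) id
      ⟨c, Finset.mem_filter.2 ⟨Finset.mem_univ _, hc⟩⟩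
    exact ⟨c, (Finset.mem_filter.1 hc).2, fun c' hc' =>
      hmax c' (Finset.mem_filter.2 ⟨Finset.mem_univ _, hc'⟩)⟩
  choose f hf hfmax using hlast
  have hnonlast : ∀ b : Fin m, ∃ r, (r, b.castSucc) ∈ Q ∧
      ∀ r', (r', b.castSucc) ∈ Q → b.castSucc < f r' → r' = r := by
    intro b
    by_cases hb : ∃ r, (r, b.castSucc) ∈ Q ∧ b.castSucc < f r
    · obtain ⟨r, hr, hlt⟩ := hb
      exact ⟨r, hr, fun r' hr' hlt' =>
        hQ.nonlast_unique hk hrow hr' (hf r') hr (hf r) hlt' hlt⟩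
    -- All ones of this column are last in their rows and recorded by f; any of them serves as g b
    -- without adding a new one.
    · obtain ⟨r, hr⟩ := hcol b.castSucc
      exact ⟨r, hr, fun r' hr' hlt' => absurd ⟨r', hr', hlt'⟩ hb⟩
  choose g hg hgu using hnonlast
  refine ⟨(f, g), ?_, ?_⟩
  · refine Finset.mem_product.2 ⟨Finset.mem_filter.2 ⟨Finset.mem_univ _, ?_⟩, Finset.mem_univ _⟩
    obtain ⟨r, hr⟩ := hcol (Fin.last m)
    exact ⟨r, le_antisymm (Fin.le_last _) (hfmax r _ hr)⟩
  · unfold decode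
    congr 1
    funext r c
    rw [Bool.eq_iff_iff, decide_eq_true_iff]
    have hmem : e r c = true ↔ (r, c) ∈ Q := by rw [hQdef, mem_onesSet]
    rw [hmem]
    constructor
    · rintro (rfl | ⟨b, rfl, rfl⟩)
      · exact hf r
      · exact hg b
    · intro hrc
      rcases (hfmax r c hrc).lt_or_eq with hlt | heq
      · right
        have hc : c ≠ Fin.last m := (hlt.trans_le (Fin.le_last _)).ne
        obtain ⟨b, rfl⟩ := Fin.exists_castSucc_eq.2 hc
        exact ⟨b, rfl, (hgu b r hrc hlt).symm⟩
      · exact Or.inl heq.symm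

theorem MinimallyNonlinear.cols_mem_Icc {k c : ℕ} (hk : 2 < k)
    {e : Matrix (Fin k) (Fin c) Bool} (h : MinimallyNonlinear ⟨k, c, e⟩) :
    c ∈ Finset.Icc ⌈((k : ℚ) + 4) / 4⌉₊ (4 * k - 4) := by
  have h1 : c ≤ 1 ∨ c ≤ 4 * k - 4 := h.minimalPattern.cols_le h.exists_one_in_col
  have h2 : k ≤ 1 ∨ k ≤ 4 * c - 4 := h.minimalPattern.rows_le h.exists_one_in_row
  refine Finset.mem_Icc.2 ⟨Nat.ceil_le.2 ?_, by omega⟩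
  have h3 : ((k + 4 : ℕ) : ℚ) ≤ ((4 * c : ℕ) : ℚ) := by
    exact_mod_cast (by omega : k + 4 ≤ 4 * c)
  push_cast at h3
  linarith

end ZeroOneMatrix

/-! ### The final count. -/

theorem mainTheorem3 (k : ℕ) (hk : 2 < k) :
    {P : ZeroOneMatrix | P.rows = k ∧ P.MinimallyNonlinear}.Finite ∧
      ({P : ZeroOneMatrix | P.rows = k ∧ P.MinimallyNonlinear}.ncard : ℤ) ≤
        ∑ i ∈ Finset.Icc ⌈((k : ℚ) + 4) / 4⌉₊ (4 * k - 4),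
          ((i : ℤ) ^ k - ((i : ℤ) - 1) ^ k) * (k : ℤ) ^ (i - 1) := by
  classical
  let I := Finset.Icc ⌈((k : ℚ) + 4) / 4⌉₊ (4 * k - 4)
  have hpos : ∀ i ∈ I, 1 ≤ i := by
    intro i hi
    have h1 : 0 < ⌈((k : ℚ) + 4) / 4⌉₊ := Nat.ceil_pos.2 (by positivity)
    exact h1.trans_le (Finset.mem_Icc.1 hi).1
  -- The codes over all admissible numbers i of columns; i - 1 counts the columns other than the
  -- last, which is why i ≥ 1 is required.
  let F : Finset ZeroOneMatrix := I.biUnion fun i =>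
    (ZeroOneMatrix.codes k (i - 1)).image (ZeroOneMatrix.decode k (i - 1))
  have hsub : {P : ZeroOneMatrix | P.rows = k ∧ P.MinimallyNonlinear} ⊆ (F : Set ZeroOneMatrix) := by
    rintro ⟨r, c, e⟩ ⟨hr, hP⟩
    replace hr : r = k := hr
    subst hr
    have hc := hP.cols_mem_Icc hk
    obtain ⟨m, rfl⟩ := Nat.exists_eq_add_of_le' (hpos c hc)
    obtain ⟨p, hp, he⟩ := hP.mem_image_decode hk
    exact Finset.mem_coe.2 (Finset.mem_biUnion.2 ⟨m + 1, hc, Finset.mem_image.2 ⟨p, hp, he⟩⟩)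
  refine ⟨F.finite_toSet.subset hsub, ?_⟩
  have h1 : {P : ZeroOneMatrix | P.rows = k ∧ P.MinimallyNonlinear}.ncard ≤ F.card := by
    rw [← Set.ncard_coe_finset]
    exact Set.ncard_le_ncard hsub F.finite_toSet
  have h2 : F.card ≤ ∑ i ∈ I, (ZeroOneMatrix.codes k (i - 1)).card :=
    Finset.card_biUnion_le.trans (Finset.sum_le_sum fun i _ => Finset.card_image_le)
  calc ({P : ZeroOneMatrix | P.rows = k ∧ P.MinimallyNonlinear}.ncard : ℤ)
      ≤ ((∑ i ∈ I, (ZeroOneMatrix.codes k (i - 1)).card : ℕ) : ℤ) := by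
        exact_mod_cast h1.trans h2
    _ = _ := by
        rw [Nat.cast_sum]
        refine Finset.sum_congr rfl fun i hi => ?_
        rw [ZeroOneMatrix.card_codes, Nat.sub_add_cancel (hpos i hi)]
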